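/- Let $S=\mathbb C\cup\{\infty\}$ be the Riemann sphere, $p\in S$ and $\lambda>-1$. (i) There is a smooth Riemannian metric $g$ on $S\setminus\{p\}$, compatible with the conformal structure of $S$, such that: (a) $g$ has a conical singularity of order $\lambda$ at $p$: in a conformal coordinate $z$ centred at $p$, $g=\rho(z)\,|z|^{2\lambda}|dz|^2$ near $z=0$ with $\rho$ continuous and positive (also at $z=0$). Moreover, for all $l\in\mathbb N$ and $\alpha\in(0,1)$, $g$ is a $C^{l,\alpha}$ cone metric: $g=e^{2v}|z|^{2\lambda}|dz|^2$ near $z=0$, $z\ne0$, where, with $z=re^{i\theta}$ and $s=2^k\frac{r^{\lambda+1}}{\lambda+1}$, the functions $(s,\theta)\mapsto v(z)$ on $(1/2,2)\times S^1$ have $C^{l,\alpha}$ norms bounded uniformly in all large $k$. (b) $g$ is rotationally symmetric: for some conformal coordinate $w:S\setminus\{p\}\to\mathbb C$, it is invariant under $w\mapsto aw$ for all $|a|=1$. (c) $g$ is a gradient shrinking Ricci soliton: for some function $f$ that is smooth on $S\setminus\{p\}$, $\tfrac12 R\,g_{ij}-g_{ij}=\nabla_{ij}f$ on $S\setminus\{p\}$,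 where $R$ is the scalar curvature of $g$ and $\nabla_{ij} f$ the covariant Hessian. (ii) For every $c>-1$ the problem $$u''+\Bigl(\tfrac1r+c\,r\,e^{2u}\Bigr)u'+(1+c)e^{2u}=0\quad(r>0),\qquad u(0)=0,\ u'(0)=0,$$ has a solution $u$ on $[0,\infty)$ that is $C^1$ up to $r=0$. For every such solution the limit $A_c=\lim_{r\to\infty}r\,u'(r)$ exists and depends only on $c$; the function $c\mapsto A_c$ is continuous on $(-1,\infty)$, with $A_c\to-1$ as $c\to\infty$ and $A_c\to-\infty$ as $c\to-1^+$. -/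

import Mathlib

open Filter Topology Set
open scoped ContDiff

noncomputable section

namespace ConicalSphere

/-! ### The Riemann sphere and its affine coordinates -/

/-- The Riemann sphere `ℂ ∪ {∞}`. The group `GL₂(ℂ)` acts on it by Möbius transformations. -/
abbrev Sphere : Type := OnePoint ℂ

/-- The conformal coordinate attached to `γ ∈ GL₂(ℂ)`: the point of the sphere whose coordinate
is `z`. It parametrizes the sphere with the one point `γ • ∞` removed. These coordinates form a
holomorphic atlas, which contains for every point one that is centred there. -/
def coord (γ : GL (Fin 2) ℂ) (z : ℂ) : Sphere := γ • (z : OnePoint ℂ)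

/-- The complex derivative at `z` of the Möbius transformation `w ↦ (a w + b) / (c w + d)`. -/
def mobiusDeriv (γ : GL (Fin 2) ℂ) (z : ℂ) : ℂ :=
  (γ 0 0 * γ 1 1 - γ 0 1 * γ 1 0) / (γ 1 0 * z + γ 1 1) ^ 2

/-- `mobiusDeriv` is indeed the derivative. -/
theorem hasDerivAt_mobius (γ : GL (Fin 2) ℂ) (z : ℂ) (h : γ 1 0 * z + γ 1 1 ≠ 0) :
    HasDerivAt (fun w : ℂ => (γ 0 0 * w + γ 0 1) / (γ 1 0 * w + γ 1 1)) (mobiusDeriv γ z) z := by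
  have h1 : HasDerivAt (fun w : ℂ => γ 0 0 * w + γ 0 1) (γ 0 0) z := by
    simpa using ((hasDerivAt_id z).const_mul (γ 0 0)).add_const (γ 0 1)
  have h2 : HasDerivAt (fun w : ℂ => γ 1 0 * w + γ 1 1) (γ 1 0) z := by
    simpa using ((hasDerivAt_id z).const_mul (γ 1 0)).add_const (γ 1 1)
  refine (h1.div h2 h).congr_deriv ?_
  unfold mobiusDeriv
  congr 1
  ring

/-- A smooth Riemannian metric on the sphere with the point `p` removed, compatible with the
conformal structure: in the coordinate `z` attached to `γ` it reads `density γ z * |dz|²`.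
The values of `density γ` at a coordinate of `p` are meaningless. -/
structure ConformalMetric (p : Sphere) where
  /-- the coefficient of `|dz|²` in each coordinate -/
  density : GL (Fin 2) ℂ → ℂ → ℝ
  density_pos : ∀ γ z, coord γ z ≠ p → 0 < density γ z
  /-- the change of coordinates `z' = (γ'⁻¹ γ) z` -/
  density_change : ∀ γ γ' z z', coord γ z = coord γ' z' → coord γ z ≠ p →
    density γ z = density γ' z' * ‖mobiusDeriv (γ'⁻¹ * γ) z‖ ^ 2
  density_smooth : ∀ γ z, coord γ z ≠ p → ContDiffAt ℝ ∞ (density γ) z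

/-- The metric is invariant under the rotations about `p`: in some coordinate in which `p` is the
point at infinity, it is invariant under `z ↦ a z` for all `|a| = 1`. -/
def ConformalMetric.IsRotationallySymmetric {p : Sphere} (g : ConformalMetric p) : Prop :=
  ∃ γ : GL (Fin 2) ℂ, γ • (OnePoint.infty : Sphere) = p ∧
    ∀ a z : ℂ, ‖a‖ = 1 → g.density γ (a * z) = g.density γ z

/-! ### Conical singularities -/

/-- The metric has a conical singularity of order `β` at `p`: in a conformal coordinate centred
at `p` it reads `ρ(z) |z|^(2β) |dz|²` near `0`, with `ρ` continuous and positive, at `0` too. -/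
def ConformalMetric.HasConicalSingularity {p : Sphere} (g : ConformalMetric p) (β : ℝ) : Prop :=
  ∃ γ : GL (Fin 2) ℂ, coord γ 0 = p ∧
    ∃ (U : Set ℂ) (ρ : ℂ → ℝ), IsOpen U ∧ 0 ∈ U ∧ ContinuousOn ρ U ∧ (∀ z ∈ U, 0 < ρ z) ∧
      ∀ z ∈ U, z ≠ 0 → g.density γ z = ρ z * ‖z‖ ^ (2 * β)

/-- The function `F` has `C^{l,α}` norm at most a multiple of `C` on `(1/2, 2) × S¹`. The variable
of the circle is lifted to `ℝ`. -/
def HolderBoundedBy (l : ℕ) (α C : ℝ) (F : ℝ × ℝ → ℝ) : Prop :=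
  ContDiffOn ℝ l F (Ioo (1 / 2) 2 ×ˢ univ) ∧
  (∀ j ≤ l, ∀ q ∈ Ioo (1 / 2 : ℝ) 2 ×ˢ (univ : Set ℝ), ‖iteratedFDeriv ℝ j F q‖ ≤ C) ∧
  ∀ q ∈ Ioo (1 / 2 : ℝ) 2 ×ˢ (univ : Set ℝ), ∀ q' ∈ Ioo (1 / 2 : ℝ) 2 ×ˢ (univ : Set ℝ),
    ‖iteratedFDeriv ℝ l F q - iteratedFDeriv ℝ l F q'‖ ≤ C * ‖q - q'‖ ^ α

/-- With `ρ = r^(β+1) / (β+1)` and `s = 2^k ρ`, the point `z = r e^{iθ}` as a function of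
`(s, θ)`. -/
def conePolar (β : ℝ) (k : ℕ) (q : ℝ × ℝ) : ℂ :=
  ((((β + 1) * (q.1 / 2 ^ k)) ^ (1 / (β + 1)) : ℝ) : ℂ) * Complex.exp (q.2 * Complex.I)

/-- The function `v`, defined near `0` in `ℂ` except at `0`, is weighted `C^{l,α}` with respect to
the cone of order `β`: its restrictions to the dyadic annuli `1/2 < 2^k ρ < 2`, rescaled to
`(1/2, 2) × S¹`, have uniformly bounded `C^{l,α}` norms as the annuli shrink to `0`. -/
def IsWeightedHolder (β : ℝ) (l : ℕ) (α : ℝ) (v : ℂ → ℝ) : Prop :=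
  ∃ (C : ℝ) (k₀ : ℕ), ∀ k ≥ k₀, HolderBoundedBy l α C (fun q => v (conePolar β k q))

/-- The metric is a `C^{l,α}` cone metric of order `β` at `p`: in a conformal coordinate centred
at `p` it reads `e^{2v} |z|^(2β) |dz|²` with `v` weighted `C^{l,α}`. -/
def ConformalMetric.IsHolderConeMetric {p : Sphere} (g : ConformalMetric p)
    (β : ℝ) (l : ℕ) (α : ℝ) : Prop :=
  ∃ γ : GL (Fin 2) ℂ, coord γ 0 = p ∧ ∃ v : ℂ → ℝ, IsWeightedHolder β l α v ∧
    ∀ᶠ z in 𝓝[≠] (0 : ℂ), g.density γ z = Real.exp (2 * v z) * ‖z‖ ^ (2 * β)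

/-! ### Curvature and Hessian in real coordinates `z = x + i y` -/

/-- The partial derivative in the direction `x` (index `0`) or `y` (index `1`). -/
def partialD (i : Fin 2) (F : ℂ → ℝ) (z : ℂ) : ℝ := fderiv ℝ F z (![1, Complex.I] i)

/-- The Christoffel symbol `Γ^k_{ij}` of the Levi-Civita connection of the metric `G`. -/
def christoffel (G : ℂ → Matrix (Fin 2) (Fin 2) ℝ) (k i j : Fin 2) (z : ℂ) : ℝ :=
  (1 / 2) * ∑ l, (G z)⁻¹ k l *
    (partialD i (fun w => G w j l) z + partialD j (fun w => G w i l) z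
      - partialD l (fun w => G w i j) z)

/-- The Ricci tensor `R_{jk}` of the metric `G`. -/
def ricci (G : ℂ → Matrix (Fin 2) (Fin 2) ℝ) (j k : Fin 2) (z : ℂ) : ℝ :=
  ∑ i, (partialD i (christoffel G i j k) z - partialD k (christoffel G i i j) z
    + ∑ l, (christoffel G i i l z * christoffel G l j k z
      - christoffel G i k l z * christoffel G l i j z))

/-- The scalar curvature of the metric `G` (twice its Gauss curvature). -/
def scalarCurvature (G : ℂ → Matrix (Fin 2) (Fin 2) ℝ) (z : ℂ) : ℝ :=
  ∑ j, ∑ k, (G z)⁻¹ j k * ricci G j k z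

/-- The covariant Hessian `∇_{ij} f` with respect to the metric `G`. -/
def covHessian (G : ℂ → Matrix (Fin 2) (Fin 2) ℝ) (f : ℂ → ℝ) (i j : Fin 2) (z : ℂ) : ℝ :=
  partialD i (partialD j f) z - ∑ k, christoffel G k i j z * partialD k f z

/-- The matrix `g_{ij}` of the metric in the real coordinates `x, y` given by
`coord γ (x + i y)`. -/
def ConformalMetric.matrix {p : Sphere} (g : ConformalMetric p) (γ : GL (Fin 2) ℂ) (z : ℂ) :
    Matrix (Fin 2) (Fin 2) ℝ := g.density γ z • (1 : Matrix (Fin 2) (Fin 2) ℝ)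

/-- The metric is a gradient Ricci soliton with constant `κ`: for some function `f`, smooth
away from `p`, one has `(1/2) R g_{ij} - κ g_{ij} = ∇_{ij} f` away from `p`. It is shrinking for
`κ > 0`. The equation is one of tensors, so it is enough to have it at each point in one
coordinate. -/
def ConformalMetric.IsGradientSoliton {p : Sphere} (g : ConformalMetric p) (κ : ℝ) : Prop :=
  ∃ f : Sphere → ℝ,
    (∀ γ z, coord γ z ≠ p → ContDiffAt ℝ ∞ (fun w => f (coord γ w)) z) ∧
    ∀ x : Sphere, x ≠ p → ∃ (γ : GL (Fin 2) ℂ) (z : ℂ), coord γ z = x ∧ ∀ i j : Fin 2,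
      (1 / 2) * scalarCurvature (g.matrix γ) z * g.matrix γ z i j - κ * g.matrix γ z i j
        = covHessian (g.matrix γ) (fun w => f (coord γ w)) i j z

/-! ### The radial soliton equation -/

/-- `u`, with derivative `u'`, is a solution on `[0, ∞)`, continuously differentiable up to `0`, of
`u'' + (1/r + c r e^{2u}) u' + (1 + c) e^{2u} = 0` for `r > 0`, with `u(0) = 0` and
`u'(0) = 0`. -/
structure IsRadialSolution (c : ℝ) (u u' : ℝ → ℝ) : Prop where
  init : u 0 = 0
  init' : u' 0 = 0
  deriv : ∀ r ≥ 0, HasDerivWithinAt u (u' r) (Ici 0) r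
  cont : ContinuousOn u' (Ici 0)
  ode : ∀ r > 0, ∃ u'' : ℝ, HasDerivAt u' u'' r ∧
    u'' + (1 / r + c * r * Real.exp (2 * u r)) * u' r + (1 + c) * Real.exp (2 * u r) = 0

end ConicalSphere

end

/-! Both parts rest on one autonomous first-order equation. For a radial metric e^{2u}|dz|² use the
normalized area E as independent variable, and write W = `profileSlope c`, P = `profile c`. The
second-order equation integrates to 1 + r u' = W(E) and r E' = r² e^{2u} = P(E), where P' = 2W and
W' = -(1 + cW). For c > -1 the function P is strictly concave with P(0) = 0, P'(0) = 2, and is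
negative somewhere on the right, so it has exactly one positive zero m = `totalArea c`.

Asymptotics (`IsRadialSolution.tendsto`): E increases to m, and W(m) = 1 - m, so r u' tends to -m.
Continuity and limits of m follow from the sign of P at fixed e as c varies.

Existence (`exists_isAreaFunction`): P has simple zeros at 0 and m, with P'(m) = 2(1 - m). Hence
G(e) = e (m - e)^{-1/(m-1)} exp(T(e)), with T smooth, linearizes the equation to P G' = 2G. Its
inverse φ gives E = φ(r²) and e^{2u} = 2φ'(r²).

The metric 2φ'(|z|²)|dz|² has R = 2(1 + cW), and f = cφ(|z|²) has Hessian cW g, which is the soliton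
equation. Near infinity E is a smooth function of x = r^{-2(m-1)}; in the coordinate 1/z the density
becomes V(|z|^{2(m-1)}) |z|^{2(m-2)} with V smooth and positive at 0, a cone of order m - 2. Since m
takes every value in (1, ∞), every order λ > -1 occurs. -/

noncomputable section

namespace ConicalSphere

/-! ### The momentum profile

Along a radial soliton metric `e^{2u}|dz|²` the function `E(r) = ∫₀^r s e^{2u(s)} ds` satisfies
`1 + r u' = profileSlope c E` and `r² e^{2u} = profile c E`. -/

/-- The value of `1 + r u'` as a function of the normalized area `e`. -/
def profileSlope (c e : ℝ) : ℝ := Real.exp (-c * e) - ∫ s in (0 : ℝ)..e, Real.exp (-c * s)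

/-- The value of `r² e^{2u}` as a function of the normalized area `e`. -/
def profile (c e : ℝ) : ℝ := 2 * ∫ s in (0 : ℝ)..e, profileSlope c s

theorem profileSlope_zero (c : ℝ) : profileSlope c 0 = 1 := by simp [profileSlope]

theorem profile_zero (c : ℝ) : profile c 0 = 0 := by simp [profile]

theorem continuous_profileSlope_uncurry : Continuous (Function.uncurry profileSlope) := by
  have h : Continuous fun q : ℝ × ℝ => ∫ s in (0 : ℝ)..q.2, Real.exp (-q.1 * s) :=
    intervalIntegral.continuous_parametric_intervalIntegral_of_continuous
      (f := fun (q : ℝ × ℝ) s => Real.exp (-q.1 * s)) (by fun_prop) continuous_snd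
  have h' : Continuous fun q : ℝ × ℝ => Real.exp (-q.1 * q.2) := by fun_prop
  exact h'.sub h

theorem continuous_profileSlope (c : ℝ) : Continuous (profileSlope c) :=
  continuous_profileSlope_uncurry.comp (by fun_prop : Continuous fun e : ℝ => (c, e))

theorem continuous_profile_left (e : ℝ) : Continuous fun c => profile c e :=
  (intervalIntegral.continuous_parametric_intervalIntegral_of_continuous'
    continuous_profileSlope_uncurry 0 e).const_mul 2

theorem hasDerivAt_profile (c e : ℝ) : HasDerivAt (profile c) (2 * profileSlope c e) e :=
  ((continuous_profileSlope c).integral_hasStrictDerivAt 0 e).hasDerivAt.const_mul 2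

theorem profileSlope_eq (c e : ℝ) :
    1 + c * profileSlope c e = (1 + c) * Real.exp (-c * e) := by
  have h : (∫ s in (0 : ℝ)..e, -c * Real.exp (-c * s)) = Real.exp (-c * e) - Real.exp (-c * 0) := by
    refine intervalIntegral.integral_eq_sub_of_hasDerivAt (f := fun s => Real.exp (-c * s))
      (fun s _ => ?_) (Continuous.intervalIntegrable (by fun_prop) _ _)
    simpa [mul_comm] using ((hasDerivAt_id s).const_mul (-c)).exp
  rw [intervalIntegral.integral_const_mul] at h
  simp only [mul_zero, Real.exp_zero] at h
  unfold profileSlope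
  linear_combination h

theorem hasDerivAt_profileSlope (c e : ℝ) :
    HasDerivAt (profileSlope c) (-(1 + c * profileSlope c e)) e := by
  have h1 : HasDerivAt (fun s => Real.exp (-c * s)) (Real.exp (-c * e) * (-c * 1)) e :=
    ((hasDerivAt_id e).const_mul (-c)).exp
  have h2 := ((by fun_prop : Continuous fun s => Real.exp (-c * s)).integral_hasStrictDerivAt
    0 e).hasDerivAt
  refine (h1.sub h2).congr_deriv ?_
  rw [profileSlope_eq]
  ring

theorem hasDerivAt_profileSlope_exp (c e : ℝ) :
    HasDerivAt (profileSlope c) (-((1 + c) * Real.exp (-c * e))) e := by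
  simpa only [profileSlope_eq] using hasDerivAt_profileSlope c e

/-- A first integral: both sides vanish at 0 and have derivative 2cW. It is kept undivided by `c` so
that c = 0 is covered. -/
theorem profile_eq (c e : ℝ) : c * profile c e = 2 * (1 - profileSlope c e - e) := by
  have h : ∀ x, HasDerivAt (fun e => c * profile c e - 2 * (1 - profileSlope c e - e)) 0 x := by
    intro x
    refine (((hasDerivAt_profile c x).const_mul c).sub
      ((((hasDerivAt_profileSlope c x).const_sub 1).sub (hasDerivAt_id x)).const_mul 2)).congr_deriv ?_
    ring
  have := is_const_of_deriv_eq_zero (fun x => (h x).differentiableAt) (fun x => (h x).deriv) e 0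
  simp only [profile_zero, profileSlope_zero] at this
  linarith

theorem strictAnti_profileSlope {c : ℝ} (hc : -1 < c) : StrictAnti (profileSlope c) :=
  strictAnti_of_deriv_neg fun e => by
    rw [(hasDerivAt_profileSlope_exp c e).deriv]
    have := mul_pos (by linarith : 0 < 1 + c) (Real.exp_pos (-c * e))
    linarith

theorem continuous_profile (c : ℝ) : Continuous (profile c) :=
  continuous_iff_continuousAt.2 fun e => (hasDerivAt_profile c e).continuousAt

theorem strictConcaveOn_profile {c : ℝ} (hc : -1 < c) : StrictConcaveOn ℝ univ (profile c) := by
  have hd : deriv (profile c) = fun e => 2 * profileSlope c e :=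
    funext fun e => (hasDerivAt_profile c e).deriv
  refine StrictAntiOn.strictConcaveOn_of_deriv convex_univ (continuous_profile c).continuousOn ?_
  rw [hd]
  intro x _ y _ hxy
  have := strictAnti_profileSlope hc hxy
  simpa using this

/-! ### The positive zero of the profile and its dependence on `c`. -/

theorem exists_profile_neg {c : ℝ} (hc : -1 < c) : ∃ e, 0 < e ∧ profile c e < 0 := by
  rcases le_or_gt c 0 with h0 | h0
  -- For c ≤ 0 one has exp(-ce) ≥ 1, so W lies below its tangent at 0. Integrating, P(e) ≤ 2e -
  -- (1+c)e², which equals -3/(1+c) at e = 3/(1+c).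
  · have hW : ∀ e, 0 ≤ e → profileSlope c e ≤ 1 - (1 + c) * e := by
      intro e he
      have h1 : 1 ≤ Real.exp (-c * e) := Real.one_le_exp (mul_nonneg (by linarith) he)
      have h2 : ∀ x, HasDerivAt (fun x => profileSlope c x - (1 - (1 + c) * x))
          ((1 + c) * (1 - Real.exp (-c * x))) x := by
        intro x
        refine ((hasDerivAt_profileSlope_exp c x).sub
          (((hasDerivAt_id x).const_mul (1 + c)).const_sub 1)).congr_deriv ?_
        ring
      have h3 : AntitoneOn (fun x => profileSlope c x - (1 - (1 + c) * x)) (Ici 0) := by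
        refine antitoneOn_of_deriv_nonpos (convex_Ici 0)
          (fun x _ => (h2 x).continuousAt.continuousWithinAt)
          (fun x _ => (h2 x).differentiableAt.differentiableWithinAt) fun x hx => ?_
        rw [interior_Ici] at hx
        rw [(h2 x).deriv]
        have : 1 ≤ Real.exp (-c * x) :=
          Real.one_le_exp (mul_nonneg (by linarith) (le_of_lt hx))
        exact mul_nonpos_of_nonneg_of_nonpos (by linarith) (by linarith)
      have := h3 (mem_Ici.2 le_rfl) (mem_Ici.2 he) he
      simp only [profileSlope_zero] at this
      linarith
    have hP : ∀ x, HasDerivAt (fun x => profile c x - (2 * x - (1 + c) * x ^ 2))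
        (2 * profileSlope c x - (2 - (1 + c) * (2 * x))) x := by
      intro x
      refine ((hasDerivAt_profile c x).sub (((hasDerivAt_id x).const_mul 2).sub
        (((hasDerivAt_id x).pow 2).const_mul (1 + c)))).congr_deriv ?_
      simp
    have h3 : AntitoneOn (fun x => profile c x - (2 * x - (1 + c) * x ^ 2)) (Ici 0) := by
      refine antitoneOn_of_deriv_nonpos (convex_Ici 0)
        (fun x _ => (hP x).continuousAt.continuousWithinAt)
        (fun x _ => (hP x).differentiableAt.differentiableWithinAt) fun x hx => ?_
      rw [interior_Ici] at hx
      rw [(hP x).deriv]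
      have := hW x (le_of_lt hx)
      linarith
    have hc1 : 0 < 1 + c := by linarith
    refine ⟨3 / (1 + c), by positivity, ?_⟩
    have := h3 (mem_Ici.2 le_rfl) (mem_Ici.2 (by positivity : 0 ≤ 3 / (1 + c))) (by positivity)
    simp only [profile_zero] at this
    have h4 : 2 * (3 / (1 + c)) - (1 + c) * (3 / (1 + c)) ^ 2 = -3 / (1 + c) := by
      field_simp
      norm_num
    have h5 : -3 / (1 + c) < 0 := div_neg_of_neg_of_pos (by norm_num) hc1
    linarith
  -- For c > 0, positivity of 1 + cW gives W > -1/c, so 1 - W - e < -1 at this e, and the first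
  -- integral makes cP negative.
  · refine ⟨2 + 1 / c, by positivity, ?_⟩
    have h1 := profile_eq c (2 + 1 / c)
    have h2 := profileSlope_eq c (2 + 1 / c)
    have h3 : 0 < (1 + c) * Real.exp (-c * (2 + 1 / c)) := by positivity
    have h4 : c * (1 / c) = 1 := by field_simp
    have h5 : 0 < profileSlope c (2 + 1 / c) + 1 / c := by
      refine pos_of_mul_pos_right (a := c) ?_ h0.le
      rw [mul_add, h4]
      linarith
    exact (pos_iff_pos_of_mul_pos (a := c) (b := -profile c (2 + 1 / c)) (by linarith)).1 h0
      |> neg_pos.1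

theorem exists_profile_zero {c : ℝ} (hc : -1 < c) : ∃ m, 0 < m ∧ profile c m = 0 := by
  obtain ⟨b, hb, hb'⟩ := exists_profile_neg hc
  have hpos : ∃ a, 0 < a ∧ a < b ∧ 0 < profile c a := by
    have h1 := (hasDerivAt_profile c 0).tendsto_slope
    rw [profileSlope_zero] at h1
    have h2 : ∀ᶠ x in 𝓝[>] (0 : ℝ), 0 < slope (profile c) 0 x :=
      (h1.mono_left (nhdsWithin_mono _ fun x hx => ne_of_gt hx)).eventually_const_lt (by norm_num)
    obtain ⟨a, ha1, ha2⟩ := (h2.and (Ioo_mem_nhdsGT hb)).exists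
    refine ⟨a, ha2.1, ha2.2, ?_⟩
    rw [slope_def_field, profile_zero, sub_zero, sub_zero] at ha1
    exact (div_pos_iff_of_pos_right ha2.1).1 ha1
  obtain ⟨a, ha, hab, hPa⟩ := hpos
  obtain ⟨m, hm, hm'⟩ := intermediate_value_Icc' hab.le (continuous_profile c).continuousOn
    (show (0 : ℝ) ∈ Icc _ _ from ⟨hb'.le, hPa.le⟩)
  exact ⟨m, ha.trans_le hm.1, hm'⟩

/-- The positive zero of `profile c`: the normalized total area of the soliton. -/
def totalArea (c : ℝ) : ℝ := if hc : -1 < c then (exists_profile_zero hc).choose else 0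

section

variable {c : ℝ} (hc : -1 < c)
include hc

theorem totalArea_pos : 0 < totalArea c := by
  rw [totalArea, dif_pos hc]
  exact (exists_profile_zero hc).choose_spec.1

theorem profile_totalArea : profile c (totalArea c) = 0 := by
  rw [totalArea, dif_pos hc]
  exact (exists_profile_zero hc).choose_spec.2

/-- Strict concavity: the chord slope over [0, e] exceeds that over [e, m], and P vanishes at both
outer ends. The two sign lemmas that follow use the same comparison. -/
theorem profile_pos {e : ℝ} (he : 0 < e) (he' : e < totalArea c) : 0 < profile c e := by
  have h := (strictConcaveOn_profile hc).slope_anti_adjacent (mem_univ 0) (mem_univ _) he he'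
  rw [profile_totalArea hc, profile_zero, zero_sub, sub_zero, sub_zero] at h
  by_contra! hn
  have h1 : profile c e / e ≤ 0 := div_nonpos_of_nonpos_of_nonneg hn he.le
  have h2 : 0 ≤ -profile c e / (totalArea c - e) := div_nonneg (by linarith) (by linarith)
  linarith

theorem profile_neg_of_totalArea_lt {e : ℝ} (he : totalArea c < e) : profile c e < 0 := by
  have h := (strictConcaveOn_profile hc).slope_anti_adjacent (mem_univ 0) (mem_univ _)
    (totalArea_pos hc) he
  rw [profile_totalArea hc, profile_zero, sub_zero, sub_zero, zero_div] at h
  by_contra! hn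
  have : 0 ≤ profile c e / (e - totalArea c) := div_nonneg hn (by linarith)
  linarith

theorem profile_neg_of_neg {e : ℝ} (he : e < 0) : profile c e < 0 := by
  have h := (strictConcaveOn_profile hc).slope_anti_adjacent (mem_univ e) (mem_univ _)
    he (totalArea_pos hc)
  rw [profile_totalArea hc, profile_zero, sub_zero, zero_div, zero_sub, zero_sub, neg_div_neg_eq] at h
  by_contra! hn
  have : profile c e / e ≤ 0 := div_nonpos_of_nonneg_of_nonpos hn he.le
  linarith

theorem profileSlope_totalArea : profileSlope c (totalArea c) = 1 - totalArea c := by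
  have h := profile_eq c (totalArea c)
  rw [profile_totalArea hc] at h
  linarith

/-- By Rolle W vanishes somewhere in (0, m). As W decreases strictly, 1 - m = W(m) < 0. -/
theorem one_lt_totalArea : 1 < totalArea c := by
  obtain ⟨ξ, hξ, h⟩ := exists_deriv_eq_zero (totalArea_pos hc) (continuous_profile c).continuousOn
    ((profile_zero c).trans (profile_totalArea hc).symm)
  rw [(hasDerivAt_profile c ξ).deriv] at h
  have h1 := strictAnti_profileSlope hc hξ.2
  rw [profileSlope_totalArea hc] at h1
  linarith

theorem lt_totalArea_of_profile_pos {e : ℝ} (h : 0 < profile c e) : e < totalArea c := by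
  by_contra! hn
  rcases hn.eq_or_lt with rfl | hn
  · exact h.ne' (profile_totalArea hc)
  · exact (profile_neg_of_totalArea_lt hc hn).not_gt h

theorem totalArea_lt_of_profile_neg {e : ℝ} (he : 0 < e) (h : profile c e < 0) :
    totalArea c < e := by
  by_contra! hn
  rcases hn.eq_or_lt with rfl | hn
  · exact h.ne (profile_totalArea hc)
  · exact (profile_pos hc he hn).not_gt h

/-- For fixed e > 0 the sign of P(e) tells on which side of e the zero lies, and a strict sign
persists under small changes of `c`. -/
theorem continuousAt_totalArea : ContinuousAt totalArea c := by
  have hev : ∀ᶠ x in 𝓝 c, -1 < x := lt_mem_nhds hc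
  refine tendsto_order.2 ⟨fun a ha => ?_, fun b hb => ?_⟩
  · obtain ⟨a', ha1, ha2⟩ := exists_between (max_lt ha (totalArea_pos hc))
    filter_upwards [hev, (continuous_profile_left a').continuousAt.eventually_const_lt
      (profile_pos hc ((le_max_right _ _).trans_lt ha1) ha2)] with x hx hx'
    exact ((le_max_left _ _).trans_lt ha1).trans (lt_totalArea_of_profile_pos hx hx')
  · filter_upwards [hev, (continuous_profile_left b).continuousAt.eventually_lt_const
      (profile_neg_of_totalArea_lt hc hb)] with x hx hx'
    exact totalArea_lt_of_profile_neg hx ((totalArea_pos hc).trans hb) hx'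

end

theorem tendsto_totalArea_atTop : Tendsto totalArea atTop (𝓝 1) := by
  refine tendsto_order.2 ⟨fun a ha => ?_, fun b hb => ?_⟩
  · filter_upwards [eventually_gt_atTop (-1)] with c hc
    exact ha.trans (one_lt_totalArea hc)
  · filter_upwards [eventually_gt_atTop (0 : ℝ), eventually_gt_atTop (1 / (b - 1))] with c hc hc'
    have hb1 : 0 < b - 1 := by linarith
    rw [div_lt_iff₀ hb1] at hc'
    -- If P(b) ≥ 0, the first integral gives cW(b) ≤ c(1 - b) < -1, against 1 + cW > 0.
    refine totalArea_lt_of_profile_neg (by linarith) (by linarith) ?_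
    have h2 := profileSlope_eq c b
    have h3 : 0 < (1 + c) * Real.exp (-c * b) := by positivity
    have h1 := profile_eq c b
    by_contra! hn
    have h4 : 0 ≤ c * (1 - profileSlope c b - b) := by
      have := mul_nonneg hc.le (mul_nonneg hc.le hn)
      rw [h1] at this
      linarith
    nlinarith

theorem tendsto_totalArea_neg_one : Tendsto totalArea (𝓝[>] (-1)) atTop := by
  refine tendsto_atTop.2 fun b => ?_
  -- At c = -1 the slope is identically 1 and P(e) = 2e has no positive zero; nearby zeros must
  -- therefore escape beyond any bound.
  have hp : 0 < profile (-1) (max b 1) := by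
    have h : ∀ e, profileSlope (-1) e = 1 := fun e => by
      have := profileSlope_eq (-1) e
      linarith
    have hb : (0 : ℝ) < max b 1 := lt_max_of_lt_right one_pos
    simp only [profile, h]
    simp [hb]
  filter_upwards [self_mem_nhdsWithin, ((continuous_profile_left (max b 1)).continuousAt.eventually_const_lt
    hp).filter_mono nhdsWithin_le_nhds] with c hc hc'
  exact (le_max_left _ _).trans (lt_totalArea_of_profile_pos hc hc').le

/-! ### Division of analytic functions and local inverses -/

theorem analyticAt_dslope {f : ℝ → ℝ} (hf : ∀ x, AnalyticAt ℝ f x) (a x : ℝ) :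
    AnalyticAt ℝ (dslope f a) x := by
  rcases eq_or_ne x a with rfl | hx
  · obtain ⟨p, hp⟩ := hf x
    exact ⟨_, hp.has_fpower_series_dslope_fslope⟩
  · refine AnalyticAt.congr ?_ (dslope_eventuallyEq_slope_of_ne f hx).symm
    have h : slope f a = fun y => (f y - f a) / (y - a) := funext fun y => slope_def_field f a y
    rw [h]
    exact ((hf x).sub analyticAt_const).div (analyticAt_id.sub analyticAt_const) (sub_ne_zero.2 hx)

theorem exists_analytic_factor {f : ℝ → ℝ} (hf : ∀ x, AnalyticAt ℝ f x) {m : ℝ} (hm : m ≠ 0)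
    (h0 : f 0 = 0) (h1 : f m = 0) :
    ∃ S : ℝ → ℝ, (∀ x, AnalyticAt ℝ S x) ∧ ∀ x, f x = x * (m - x) * S x := by
  have e1 : ∀ x, f x = x * dslope f 0 x := fun x => by
    simpa [h0] using (sub_smul_dslope f 0 x).symm
  have h2 : dslope f 0 m = 0 := by
    have := e1 m
    rw [h1] at this
    exact (mul_eq_zero.1 this.symm).resolve_left hm
  have e2 : ∀ x, dslope f 0 x = (x - m) * dslope (dslope f 0) m x := fun x => by
    simpa [h2] using (sub_smul_dslope (dslope f 0) m x).symm
  refine ⟨fun x => -dslope (dslope f 0) m x,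
    fun x => (analyticAt_dslope (analyticAt_dslope hf 0) m x).neg, fun x => ?_⟩
  rw [e1, e2]
  ring

theorem exists_local_inverse {G : ℝ → ℝ} {e d : ℝ} (hG : ContDiffAt ℝ ∞ G e)
    (hd : HasDerivAt G d e) (h0 : d ≠ 0) :
    ∃ χ : ℝ → ℝ, ContDiffAt ℝ ∞ χ (G e) ∧ χ (G e) = e ∧ ∀ᶠ y in 𝓝 (G e), G (χ y) = y := by
  have hf' := hd.hasFDerivAt_equiv h0
  have hn : (∞ : WithTop ℕ∞) ≠ 0 := by simp
  exact ⟨hG.localInverse hf' hn, hG.to_localInverse hf' hn, hG.localInverse_apply_image hf' hn,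
    (hG.hasStrictFDerivAt' hf' hn).eventually_right_inverse⟩

theorem contDiff_of_hasDerivAt {T S : ℝ → ℝ} (hS : ContDiff ℝ ∞ S) (h : ∀ x, HasDerivAt T (S x) x) :
    ContDiff ℝ ∞ T := by
  rw [contDiff_infty_iff_deriv]
  refine ⟨fun x => (h x).differentiableAt, ?_⟩
  rwa [funext fun x => (h x).deriv]

/-! ### The factorization of the profile -/

theorem analyticAt_profile (c e : ℝ) : AnalyticAt ℝ (profile c) e := by
  rcases eq_or_ne c 0 with rfl | hc
  · have h : profile 0 = fun e => 2 * e - e ^ 2 := by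
      funext e
      simp only [profile, profileSlope, neg_zero, zero_mul, Real.exp_zero,
        intervalIntegral.integral_const, sub_zero, smul_eq_mul, mul_one]
      rw [intervalIntegral.integral_sub (by simp) (Continuous.intervalIntegrable (by fun_prop) _ _)]
      simp
      ring
    rw [h]
    fun_prop
  · have h : profile c = fun e =>
        2 / c * (1 - ((1 + c) * Real.exp (-c * e) - 1) / c - e) := by
      funext e
      have h1 := profile_eq c e
      have h2 := profileSlope_eq c e
      have h3 : profileSlope c e = ((1 + c) * Real.exp (-c * e) - 1) / c := by
        rw [eq_div_iff hc]
        linarith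
      rw [← h3]
      field_simp
      linarith
    rw [h]
    fun_prop

/-- Both zeros are divided out. The endpoint values of `R` encode P'(0) = 2 and P'(m) = 2(1 - m);
positivity elsewhere is the sign of P against that of x(m - x). -/
theorem exists_profile_factor {c : ℝ} (hc : -1 < c) :
    ∃ R : ℝ → ℝ, (∀ x, AnalyticAt ℝ R x) ∧ (∀ x, 0 < R x) ∧
      (∀ x, profile c x = x * (totalArea c - x) * R x) ∧ totalArea c * R 0 = 2 ∧
      totalArea c * R (totalArea c) = 2 * (totalArea c - 1) := by
  have hm := totalArea_pos hc
  obtain ⟨R, hR, hP⟩ := exists_analytic_factor (analyticAt_profile c) hm.ne' (profile_zero c)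
    (profile_totalArea hc)
  have hd : ∀ x, 2 * profileSlope c x =
      (totalArea c - 2 * x) * R x + x * (totalArea c - x) * deriv R x := by
    intro x
    have h := (((hasDerivAt_id x).mul ((hasDerivAt_id x).const_sub (totalArea c))).mul
      (hR x).differentiableAt.hasDerivAt)
    have h' := h.unique ((hasDerivAt_profile c x).congr_of_eventuallyEq
      (Eventually.of_forall fun y => by simpa using (hP y).symm))
    rw [← h']
    simp only [id, Pi.mul_apply]
    ring
  have h0 : totalArea c * R 0 = 2 := by
    have := hd 0
    rw [profileSlope_zero] at this
    linarith
  have h1 : totalArea c * R (totalArea c) = 2 * (totalArea c - 1) := by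
    have := hd (totalArea c)
    rw [profileSlope_totalArea hc] at this
    linarith
  refine ⟨R, hR, fun x => ?_, hP, h0, h1⟩
  have h2 := one_lt_totalArea hc
  rcases lt_trichotomy x 0 with hx | rfl | hx
  · have h3 := profile_neg_of_neg hc hx
    rw [hP] at h3
    exact pos_of_mul_neg_right h3 (mul_nonpos_of_nonpos_of_nonneg hx.le (by linarith))
  · exact pos_of_mul_pos_right (h0 ▸ two_pos) hm.le
  rcases lt_trichotomy x (totalArea c) with hx' | rfl | hx'
  · have h3 := profile_pos hc hx hx'
    rw [hP] at h3
    exact pos_of_mul_pos_right h3 (mul_nonneg hx.le (by linarith))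
  · exact pos_of_mul_pos_right (a := totalArea c) (by linarith) hm.le
  · have h3 := profile_neg_of_totalArea_lt hc hx'
    rw [hP] at h3
    exact pos_of_mul_neg_right h3 (mul_nonpos_of_nonneg_of_nonpos hx.le (by linarith))

/-- A solution `T` of the linearization problem for the profile: with it, the function
`e (m - e)^(-1/(m-1)) exp (T e)`, `m = totalArea c`, solves `profile c e * G' = 2 G`. -/
theorem exists_linearizing_exponent {c : ℝ} (hc : -1 < c) :
    ∃ R T S : ℝ → ℝ, ContDiff ℝ ∞ R ∧ ContDiff ℝ ∞ T ∧ (∀ x, 0 < R x) ∧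
      (∀ x, profile c x = x * (totalArea c - x) * R x) ∧ totalArea c * R 0 = 2 ∧
      (∀ x, HasDerivAt T (S x) x) ∧
      T 0 = Real.log (2 * totalArea c ^ (1 / (totalArea c - 1))) ∧
      ∀ x, (totalArea c - x) + 1 / (totalArea c - 1) * x + x * (totalArea c - x) * S x
        = 2 / R x := by
  obtain ⟨R, hR, hR0, hP, h0, h1⟩ := exists_profile_factor hc
  have hm := totalArea_pos hc
  have hm1 := one_lt_totalArea hc
  set m := totalArea c
  have hm1' : m - 1 ≠ 0 := by linarith
  -- The condition G'/G = 2/P reads 1/x + b/(m - x) + T' = 2/(x(m - x)R), with b = 1/(m - 1). Thus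
  -- T' = S is a quotient by x(m - x). Its numerator vanishes at 0 and at m by the endpoint values
  -- of `R`; the latter fixes the exponent b.
  obtain ⟨S, hS, hSf⟩ := exists_analytic_factor
    (f := fun x => 2 / R x - (m - x) - 1 / (m - 1) * x)
    (fun x => ((analyticAt_const.div (hR x) (hR0 x).ne').sub
      (analyticAt_const.sub analyticAt_id)).sub (analyticAt_const.mul analyticAt_id)) hm.ne'
    (by
      have : R 0 ≠ 0 := (hR0 0).ne'
      simp only [sub_zero, mul_zero]
      field_simp
      linarith)
    (by
      have h2 : R m = 2 * (m - 1) / m := by field_simp; linarith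
      simp only [h2]
      field_simp
      ring)
  have hSc : ContDiff ℝ ∞ S := contDiff_iff_contDiffAt.2 fun x => (hS x).contDiffAt
  have hT : ∀ x, HasDerivAt (fun x => Real.log (2 * m ^ (1 / (m - 1))) + ∫ s in (0 : ℝ)..x, S s)
      (S x) x := fun x =>
    ((hSc.continuous.integral_hasStrictDerivAt 0 x).hasDerivAt).const_add _
  refine ⟨R, _, S, contDiff_iff_contDiffAt.2 fun x => (hR x).contDiffAt,
    contDiff_of_hasDerivAt hSc hT, hR0, hP, h0, hT, by simp, fun x => ?_⟩
  linarith [hSf x]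

/-! ### The area as a function of `r²` -/

/-- The function `φ` gives the normalized area of the disc of radius `r` as `φ (r²)`; its
behaviour at infinity is described in terms of `x = r^(-2(m-1))`, where `m` is the total area. -/
structure IsAreaFunction (c : ℝ) (φ : ℝ → ℝ) : Prop where
  smooth : ∀ t, 0 ≤ t → ContDiffAt ℝ ∞ φ t
  deriv_zero : deriv φ 0 = 1 / 2
  deriv_pos : ∀ t, 0 ≤ t → 0 < deriv φ t
  eqn : ∀ t, 0 ≤ t → ∀ᶠ s in 𝓝 t, s * deriv φ s = profile c (φ s) / 2
  at_infinity : ∃ V : ℝ → ℝ, ContDiffAt ℝ ∞ V 0 ∧ 0 < V 0 ∧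
    ∀ᶠ x in 𝓝[>] 0, profile c (φ (x ^ (-1 / (totalArea c - 1)))) / x = V x

theorem exists_isAreaFunction {c : ℝ} (hc : -1 < c) : ∃ φ, IsAreaFunction c φ := by
  obtain ⟨R, T, S, hRs, hTs, hR, hP, hR0, hT, hT0, hS⟩ := exists_linearizing_exponent hc
  have hm := totalArea_pos hc
  have hm1 := one_lt_totalArea hc
  set m := totalArea c
  have hβ : 0 < m - 1 := by linarith
  set b := 1 / (m - 1) with hb
  have hb0 : 0 < b := by positivity
  set G : ℝ → ℝ := fun e => e * (m - e) ^ (-b) * Real.exp (T e) with hG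
  set G' : ℝ → ℝ := fun e => (m - e) ^ (-b) * Real.exp (T e) * (2 / (R e * (m - e))) with hG'
  have hG'pos : ∀ e < m, 0 < G' e := fun e he => by
    have h1 : 0 < m - e := by linarith
    have := hR e
    simp only [hG']
    positivity
  have hGd : ∀ e < m, HasDerivAt G (G' e) e := by
    intro e he
    have h1 : 0 < m - e := by linarith
    have h2 : HasDerivAt (fun e => (m - e) ^ (-b)) (-1 * (-b) * (m - e) ^ (-b - 1)) e :=
      ((hasDerivAt_id e).const_sub m).rpow_const (Or.inl h1.ne')
    refine (((hasDerivAt_id e).mul h2).mul (hT e).exp).congr_deriv ?_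
    have h3 := hS e
    have h4 := (hR e).ne'
    rw [Real.rpow_sub_one h1.ne']
    simp only [hG', id]
    have h5 : 2 / (R e * (m - e)) = 2 / R e / (m - e) := by field_simp
    rw [h5, ← h3]
    simp only [Pi.mul_apply, id]
    field_simp
  have hGs : ∀ e < m, ContDiffAt ℝ ∞ G e := by
    intro e he
    have h1 : m - e ≠ 0 := by linarith
    refine (contDiffAt_id.mul ?_).mul (hTs.contDiffAt.exp)
    exact (contDiffAt_const.sub contDiffAt_id).rpow_const_of_ne h1
  have hmono : StrictMonoOn G (Iio m) := by
    refine strictMonoOn_of_deriv_pos (convex_Iio m)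
      (fun e he => (hGd e he).continuousAt.continuousWithinAt) fun e he => ?_
    rw [interior_Iio] at he
    rw [(hGd e he).deriv]
    exact hG'pos e he
  set φ := Function.invFunOn G (Iio m) with hφ
  have hinv : ∀ e < m, φ (G e) = e := fun e he => hmono.injOn.leftInvOn_invFunOn he
  have hG0 : G 0 = 0 := by simp [hG]
  have htop : Tendsto G (𝓝[<] m) atTop := by
    have h1 : Tendsto (fun e => m - e) (𝓝[<] m) (𝓝[>] 0) := by
      refine tendsto_nhdsWithin_iff.2 ⟨?_, ?_⟩
      · have : Tendsto (fun e => m - e) (𝓝 m) (𝓝 (m - m)) := by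
          exact (continuous_const.sub continuous_id).tendsto m
        rw [sub_self] at this
        exact this.mono_left nhdsWithin_le_nhds
      · filter_upwards [self_mem_nhdsWithin] with e he
        simpa using he
    have h2 := (tendsto_rpow_neg_nhdsGT_zero (neg_lt_zero.2 hb0)).comp h1
    have h3 : Tendsto (fun e => e * Real.exp (T e)) (𝓝[<] m) (𝓝 (m * Real.exp (T m))) :=
      ((continuous_id.mul hTs.continuous.rexp).tendsto m).mono_left nhdsWithin_le_nhds
    refine (h3.pos_mul_atTop (by positivity) h2).congr fun e => ?_
    simp only [hG, Function.comp]
    ring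
  have hsurj : ∀ t, 0 ≤ t → ∃ e, 0 ≤ e ∧ e < m ∧ G e = t := by
    intro t ht
    have := (isPreconnected_Ico (a := 0) (b := m)).intermediate_value_Ici
      (left_mem_Ico.2 hm) (l := 𝓝[<] m) (le_principal_iff.2 (Ico_mem_nhdsLT hm))
      (fun e he => (hGd e he.2).continuousAt.continuousWithinAt) htop
    obtain ⟨e, he, rfl⟩ := this (by rwa [hG0])
    exact ⟨e, he.1, he.2, rfl⟩
  -- By injectivity the global inverse agrees with the smooth local one. Allowing negative e gives a
  -- two-sided neighbourhood of t = 0.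
  have hloc : ∀ e < m, ContDiffAt ℝ ∞ φ (G e) ∧
      ∀ᶠ y in 𝓝 (G e), φ y < m ∧ G (φ y) = y := by
    intro e he
    obtain ⟨χ, hχ, hχe, hGχ⟩ := exists_local_inverse (hGs e he) (hGd e he) (hG'pos e he).ne'
    have h1 : ∀ᶠ y in 𝓝 (G e), χ y < m :=
      hχ.continuousAt.eventually_lt_const (by rwa [hχe])
    have h2 : ∀ᶠ y in 𝓝 (G e), φ y = χ y := by
      filter_upwards [h1, hGχ] with y hy hy'
      rw [← hinv _ hy, hy']
    refine ⟨hχ.congr_of_eventuallyEq h2, ?_⟩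
    filter_upwards [h1, hGχ, h2] with y hy hy' hy''
    rw [hy'']
    exact ⟨hy, hy'⟩
  have hφd : ∀ e < m, HasDerivAt φ (1 / G' e) (G e) := by
    intro e he
    obtain ⟨h1, h2⟩ := hloc e he
    have h3 := (hGd e he)
    rw [← hinv e he] at h3
    have := HasDerivAt.of_local_left_inverse h1.continuousAt h3
      (by rw [hinv e he]; exact (hG'pos e he).ne') (h2.mono fun y hy => hy.2)
    rwa [hinv e he, ← one_div] at this
  have hGP : ∀ e < m, G e * (1 / G' e) = profile c e / 2 := by
    intro e he
    have h1 : 0 < m - e := by linarith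
    have h2 := hR e
    have h3 : 0 < (m - e) ^ (-b) := Real.rpow_pos_of_pos h1 _
    rw [hP]
    simp only [hG, hG']
    field_simp
  refine ⟨φ, ?_, ?_, ?_, ?_, ?_⟩
  · intro t ht
    obtain ⟨e, -, he, rfl⟩ := hsurj t ht
    exact (hloc e he).1
  -- The value of T(0) was chosen to give G'(0) = 2; in terms of u this is u(0) = 0.
  · have h1 := hφd 0 hm
    rw [hG0] at h1
    rw [h1.deriv]
    have h2 : 0 < m ^ b := Real.rpow_pos_of_pos hm _
    simp only [hG', sub_zero, hT0]
    rw [Real.exp_log (by positivity), mul_comm (R 0), hR0, Real.rpow_neg hm.le]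
    field_simp
  · intro t ht
    obtain ⟨e, -, he, rfl⟩ := hsurj t ht
    rw [(hφd e he).deriv]
    exact one_div_pos.2 (hG'pos e he)
  · intro t ht
    obtain ⟨e, -, he, rfl⟩ := hsurj t ht
    filter_upwards [(hloc e he).2] with y hy
    have h1 := hφd _ hy.1
    rw [hy.2] at h1
    rw [h1.deriv]
    nth_rewrite 1 [← hy.2]
    exact hGP _ hy.1
  -- On (0, m) this is G^{-(m-1)}, that is, x as a function of e. Unlike G it is smooth across m,
  -- where it has a simple zero, so it has a smooth local inverse χ with χ(0) = m. In P(χ)/x the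
  -- factor m - χ cancels.
  · set K : ℝ → ℝ := fun e => e ^ (-(m - 1)) * (m - e) * Real.exp (-(m - 1) * T e) with hK
    have hKs : ContDiffAt ℝ ∞ K m := by
      refine ((contDiffAt_id.rpow_const_of_ne hm.ne').mul
        (contDiffAt_const.sub contDiffAt_id)).mul (contDiffAt_const.mul hTs.contDiffAt).exp
    have hKm : K m = 0 := by simp [hK]
    have hKd : HasDerivAt K (-(m ^ (-(m - 1)) * Real.exp (-(m - 1) * T m))) m := by
      have h1 : HasDerivAt (fun e : ℝ => e ^ (-(m - 1)))
          (1 * (-(m - 1)) * m ^ (-(m - 1) - 1)) m :=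
        (hasDerivAt_id m).rpow_const (Or.inl hm.ne')
      refine ((h1.mul ((hasDerivAt_id m).const_sub m)).mul
        ((hT m).const_mul (-(m - 1))).exp).congr_deriv ?_
      simp
    have hKne : -(m ^ (-(m - 1)) * Real.exp (-(m - 1) * T m)) ≠ 0 := by
      have := Real.rpow_pos_of_pos hm (-(m - 1))
      exact neg_ne_zero.2 (by positivity)
    obtain ⟨χ, hχ, hχm, hKχ⟩ := exists_local_inverse hKs hKd hKne
    rw [hKm] at hχ hχm hKχ
    have hχpos : ∀ᶠ x in 𝓝 (0 : ℝ), 0 < χ x :=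
      hχ.continuousAt.eventually_const_lt (by rwa [hχm])
    refine ⟨fun x => χ x ^ m * R (χ x) * Real.exp ((m - 1) * T (χ x)), ?_, ?_, ?_⟩
    · exact ((hχ.rpow_const_of_ne (by rw [hχm]; exact hm.ne')).mul
        (hRs.contDiffAt.comp 0 hχ)).mul (contDiffAt_const.mul (hTs.contDiffAt.comp 0 hχ)).exp
    · have := hR m
      simp only [hχm]
      positivity
    · filter_upwards [hχpos.filter_mono nhdsWithin_le_nhds, hKχ.filter_mono nhdsWithin_le_nhds,
        self_mem_nhdsWithin] with x hx hKx hx0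
      rw [mem_Ioi] at hx0
      set e := χ x
      have hp : 0 < e ^ (-(m - 1)) := Real.rpow_pos_of_pos hx _
      have he : 0 < m - e := by
        rw [← hKx] at hx0
        simp only [hK] at hx0
        exact pos_of_mul_pos_right (pos_of_mul_pos_left hx0 (Real.exp_pos _).le) hp.le
      have hGe : G e = x ^ (-1 / (m - 1)) := by
        rw [← hKx]
        simp only [hG, hK]
        rw [Real.mul_rpow (by positivity) (Real.exp_pos _).le, Real.mul_rpow hp.le he.le,
          ← Real.rpow_mul hx.le, ← Real.exp_mul]
        have h1 : -(m - 1) * (-1 / (m - 1)) = 1 := by field_simp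
        have h2 : -(m - 1) * T e * (-1 / (m - 1)) = T e := by field_simp
        rw [h1, h2, Real.rpow_one, hb, neg_div]
      rw [← hGe, hinv e (by linarith), hP, ← hKx]
      simp only [hK]
      have h3 : Real.exp (-(m - 1) * T e) = (Real.exp ((m - 1) * T e))⁻¹ := by
        rw [neg_mul, Real.exp_neg]
      have h4 : e ^ m = e * e ^ (m - 1) := by
        rw [← Real.rpow_one_add' hx.le (by linarith)]
        ring_nf
      rw [h3, h4, Real.rpow_neg hx.le]
      have := Real.rpow_pos_of_pos hx (m - 1)
      have := Real.exp_pos ((m - 1) * T e)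
      field_simp

/-! ### Existence of radial solutions -/

namespace IsAreaFunction

variable {c : ℝ} {φ : ℝ → ℝ} (hφ : IsAreaFunction c φ)
include hφ

theorem contDiffAt_deriv {t : ℝ} (ht : 0 ≤ t) : ContDiffAt ℝ ∞ (deriv φ) t :=
  (hφ.smooth t ht).derivWithin (m := ∞) (by simp)

theorem hasDerivAt {t : ℝ} (ht : 0 ≤ t) : HasDerivAt φ (deriv φ t) t :=
  ((hφ.smooth t ht).differentiableAt (by simp)).hasDerivAt

theorem hasDerivAt_deriv {t : ℝ} (ht : 0 ≤ t) : HasDerivAt (deriv φ) (deriv (deriv φ) t) t :=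
  ((hφ.contDiffAt_deriv ht).differentiableAt (by simp)).hasDerivAt

/-- Differentiating tφ' = P(φ)/2. With e^{2u} = 2φ'(r²) this is r u' = W(E) - 1. -/
theorem eventually_mul_deriv_deriv {t : ℝ} (ht : 0 ≤ t) :
    ∀ᶠ s in 𝓝 t, s * deriv (deriv φ) s = (profileSlope c (φ s) - 1) * deriv φ s := by
  have h2 : ∀ᶠ s in 𝓝 t, ContDiffAt ℝ 2 φ s :=
    ((hφ.smooth t ht).of_le (by exact WithTop.coe_le_coe.2 le_top)).eventually (by simp)
  filter_upwards [(hφ.eqn t ht).eventually_nhds, h2] with s hs hs2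
  have h3 : HasDerivAt φ (deriv φ s) s := (hs2.differentiableAt (by simp)).hasDerivAt
  have h4 : HasDerivAt (deriv φ) (deriv (deriv φ) s) s :=
    ((hs2.derivWithin (m := 1) (by norm_num)).differentiableAt (by simp)).hasDerivAt
  have h5 := ((hasDerivAt_profile c (φ s)).comp s h3).div_const 2
  have h6 := ((hasDerivAt_id s).mul h4).unique (h5.congr_of_eventuallyEq hs)
  simp only [id] at h6
  linarith

end IsAreaFunction

theorem hasDerivAt_comp_sq {f : ℝ → ℝ} {f' r : ℝ} (hf : HasDerivAt f f' (r ^ 2)) :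
    HasDerivAt (fun r : ℝ => f (r ^ 2)) (f' * (2 * r)) r :=
  HasDerivAt.comp (h := fun r : ℝ => r ^ 2) r hf (by simpa using hasDerivAt_pow 2 r)

theorem exists_isRadialSolution {c : ℝ} (hc : -1 < c) :
    ∃ u u' : ℝ → ℝ, IsRadialSolution c u u' := by
  obtain ⟨φ, hφ⟩ := exists_isAreaFunction hc
  set ψ := deriv φ with hψ
  have hsq : ∀ r : ℝ, 0 ≤ r ^ 2 := fun r => sq_nonneg r
  have hψd : ∀ r : ℝ, HasDerivAt (fun r : ℝ => ψ (r ^ 2)) (deriv ψ (r ^ 2) * (2 * r)) r := fun r =>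
    hasDerivAt_comp_sq (hφ.hasDerivAt_deriv (hsq r))
  have hpos : ∀ r : ℝ, 0 < ψ (r ^ 2) := fun r => hφ.deriv_pos _ (hsq r)
  have hu : ∀ r : ℝ, HasDerivAt (fun r : ℝ => 1 / 2 * Real.log (2 * ψ (r ^ 2)))
      (r * deriv ψ (r ^ 2) / ψ (r ^ 2)) r := by
    intro r
    have := hpos r
    refine ((((hψd r).const_mul 2).log (by positivity)).const_mul (1 / 2)).congr_deriv ?_
    field_simp
  have hexp : ∀ r : ℝ, Real.exp (2 * (1 / 2 * Real.log (2 * ψ (r ^ 2)))) = 2 * ψ (r ^ 2) := by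
    intro r
    have := hpos r
    rw [← mul_assoc, mul_one_div_cancel two_ne_zero, one_mul, Real.exp_log (by positivity)]
  refine ⟨fun r => 1 / 2 * Real.log (2 * ψ (r ^ 2)), fun r => r * deriv ψ (r ^ 2) / ψ (r ^ 2),
    ?_, ?_, ?_, ?_, ?_⟩
  · simp [hψ, hφ.deriv_zero]
  · simp
  · exact fun r _ => (hu r).hasDerivWithinAt
  · intro r _
    refine ContinuousAt.continuousWithinAt ?_
    have h1 : ContinuousAt (deriv ψ) (r ^ 2) :=
      ((hφ.contDiffAt_deriv (hsq r)).derivWithin (m := ∞) (by simp)).continuousAt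
    have h2 : ContinuousAt (fun r : ℝ => deriv ψ (r ^ 2)) r :=
      ContinuousAt.comp (f := fun r : ℝ => r ^ 2) h1 (by fun_prop)
    exact (continuousAt_id.mul h2).div (hψd r).continuousAt (hpos r).ne'
  · intro r hr
    have hev : ∀ᶠ s in 𝓝 r, s * deriv ψ (s ^ 2) / ψ (s ^ 2)
        = (profileSlope c (φ (s ^ 2)) - 1) / s := by
      filter_upwards [(by fun_prop : Continuous fun s : ℝ => s ^ 2).continuousAt.eventually
        (hφ.eventually_mul_deriv_deriv (hsq r)), lt_mem_nhds hr] with s hs hs0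
      have := hpos s
      rw [div_eq_div_iff this.ne' hs0.ne', ← hs]
      ring
    have h1 : HasDerivAt (fun s : ℝ => φ (s ^ 2)) (ψ (r ^ 2) * (2 * r)) r :=
      hasDerivAt_comp_sq (hφ.hasDerivAt (hsq r))
    have h2 : HasDerivAt (fun s => profileSlope c (φ (s ^ 2)))
        (-(1 + c * profileSlope c (φ (r ^ 2))) * (ψ (r ^ 2) * (2 * r))) r :=
      HasDerivAt.comp (h₂ := profileSlope c) (h := fun s => φ (s ^ 2)) r
        (hasDerivAt_profileSlope c _) h1
    refine ⟨_, ((h2.sub_const 1).div (hasDerivAt_id r) hr.ne').congr_of_eventuallyEq hev, ?_⟩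
    rw [hexp, hev.self_of_nhds]
    simp only [id]
    field_simp
    ring

/-! ### Asymptotics of radial solutions -/

theorem eq_zero_of_hasDerivAt_zero {f : ℝ → ℝ} (hc : ContinuousOn f (Ici 0))
    (hd : ∀ r > 0, HasDerivAt f 0 r) (h0 : f 0 = 0) {r : ℝ} (hr : 0 ≤ r) : f r = 0 := by
  rcases hr.eq_or_lt with rfl | hr
  · exact h0
  · obtain ⟨x, -, hx⟩ := exists_hasDerivAt_eq_slope f (fun _ => 0) hr
      (hc.mono Icc_subset_Ici_self) fun x hx => hd x hx.1
    rw [h0, sub_zero, sub_zero, eq_comm, div_eq_zero_iff] at hx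
    exact hx.resolve_right hr.ne'

/-- A function `E` with `r E' → L > 0` grows at least logarithmically. -/
theorem not_bddAbove_of_mul_deriv_tendsto {E E' : ℝ → ℝ} {L : ℝ} (hL : 0 < L)
    (hE : ∀ r > 0, HasDerivAt E (E' r) r) (hlim : Tendsto (fun r => r * E' r) atTop (𝓝 L)) :
    ¬ BddAbove (range E) := by
  rintro ⟨B, hB⟩
  obtain ⟨a, ha⟩ := (((hlim.eventually_const_lt (half_lt_self hL)).and
    (eventually_gt_atTop 0)).exists_forall_of_atTop)
  have ha0 : 0 < a := (ha a le_rfl).2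
  have hd : ∀ r ∈ Ici a, HasDerivAt (fun r => E r - L / 2 * Real.log r) (E' r - L / 2 * r⁻¹) r :=
    fun r hr => (hE r (ha r hr).2).sub ((Real.hasDerivAt_log (ha r hr).2.ne').const_mul _)
  have hmono : MonotoneOn (fun r => E r - L / 2 * Real.log r) (Ici a) := by
    refine monotoneOn_of_deriv_nonneg (convex_Ici a)
      (fun r hr => (hd r hr).continuousAt.continuousWithinAt)
      (fun r hr => (hd r (interior_subset hr)).differentiableAt.differentiableWithinAt)
      fun r hr => ?_
    have hr' := interior_subset hr
    obtain ⟨h1, h2⟩ := ha r hr'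
    rw [(hd r hr').deriv, ← div_eq_mul_inv, sub_nonneg, div_le_iff₀ h2]
    linarith
  have h3 : Tendsto (fun r => L / 2 * Real.log r) atTop atTop :=
    Real.tendsto_log_atTop.const_mul_atTop (half_pos hL)
  obtain ⟨r, hr1, hr2⟩ := ((h3.eventually_gt_atTop (B - (E a - L / 2 * Real.log a))).and
    (eventually_ge_atTop a)).exists
  have h4 := hmono (mem_Ici.2 le_rfl) (mem_Ici.2 hr2) hr2
  have h5 := hB (mem_range_self r)
  simp only at h4
  linarith

theorem IsRadialSolution.tendsto {c : ℝ} (hc : -1 < c) {u u' : ℝ → ℝ}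
    (h : IsRadialSolution c u u') : Tendsto (fun r => r * u' r) atTop (𝓝 (-totalArea c)) := by
  have hucont : ContinuousOn u (Ici 0) := fun r hr => (h.deriv r hr).continuousWithinAt
  -- Nothing is known about `u` on negative arguments; the truncation makes the integrand continuous
  -- on the whole line.
  set ρ : ℝ → ℝ := fun s => max s 0 * Real.exp (2 * u (max s 0)) with hρ
  have hρc : Continuous ρ := by
    have h1 : Continuous fun s : ℝ => max s 0 := by fun_prop
    have h2 : Continuous fun s : ℝ => u (max s 0) :=
      hucont.comp_continuous h1 fun s => mem_Ici.2 (le_max_right _ _)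
    exact h1.mul (h2.const_mul 2).rexp
  have hρr : ∀ r : ℝ, 0 < r → ρ r = r * Real.exp (2 * u r) := fun r hr => by
    simp [hρ, max_eq_left hr.le]
  set E : ℝ → ℝ := fun r => ∫ s in (0 : ℝ)..r, ρ s with hE
  have hE0 : E 0 = 0 := by simp [hE]
  have hEd : ∀ r, HasDerivAt E (ρ r) r := fun r => (hρc.integral_hasStrictDerivAt 0 r).hasDerivAt
  have hEcont : Continuous E := continuous_iff_continuousAt.2 fun r => (hEd r).continuousAt
  have hEmono : Monotone E := monotone_of_deriv_nonneg (fun r => (hEd r).differentiableAt)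
    fun r => by
      rw [(hEd r).deriv]
      exact mul_nonneg (le_max_right _ _) (Real.exp_pos _).le
  have hud : ∀ r > 0, HasDerivAt u (u' r) r := fun r hr =>
    (h.deriv r (le_of_lt hr)).hasDerivAt (Ici_mem_nhds hr)
  have hw : ∀ r, 0 ≤ r → 1 + r * u' r = profileSlope c (E r) := by
    intro r hr
    have := eq_zero_of_hasDerivAt_zero
      -- As functions of E, both 1 + r u' and W satisfy dw/dE = -(1 + cw). Their difference is
      -- killed by the integrating factor exp(cE) and the common initial value 1.
      (f := fun r => (1 + r * u' r - profileSlope c (E r)) * Real.exp (c * E r)) ?_ ?_ ?_ hr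
    · have h1 := (mul_eq_zero.1 this).resolve_right (Real.exp_pos _).ne'
      linarith
    · have h1 := (continuous_profileSlope c).comp hEcont
      have h2 : Continuous fun r => Real.exp (c * E r) := by fun_prop
      exact ((continuousOn_const.add (continuousOn_id.mul h.cont)).sub h1.continuousOn).mul
        h2.continuousOn
    · intro s hs
      obtain ⟨u'', hu'', hode⟩ := h.ode s hs
      have h1 := ((((hasDerivAt_id s).mul hu'').const_add 1).sub
        ((hasDerivAt_profileSlope c (E s)).comp s (hEd s))).mul (((hEd s).const_mul c).exp)
      refine h1.congr_deriv ?_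
      have h2 : u'' = -((1 / s + c * s * Real.exp (2 * u s)) * u' s
        + (1 + c) * Real.exp (2 * u s)) := by linarith
      simp only [Pi.mul_apply, Function.comp, id, Pi.sub_apply]
      rw [hρr s hs, h2]
      field_simp
      ring
    · simp [hE0, profileSlope_zero]
  have hy : ∀ r, 0 ≤ r → r ^ 2 * Real.exp (2 * u r) = profile c (E r) := by
    intro r hr
    have := eq_zero_of_hasDerivAt_zero
      (f := fun r => r ^ 2 * Real.exp (2 * u r) - profile c (E r)) ?_ ?_ ?_ hr
    · exact sub_eq_zero.1 this
    · have h1 := (continuous_profile c).comp hEcont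
      exact (by fun_prop : ContinuousOn (fun r : ℝ => r ^ 2 * Real.exp (2 * u r)) (Ici 0)).sub
        h1.continuousOn
    · intro s hs
      have h1 := ((hasDerivAt_pow 2 s).mul (((hud s hs).const_mul 2).exp)).sub
        ((hasDerivAt_profile c (E s)).comp s (hEd s))
      refine h1.congr_deriv ?_
      rw [hρr s hs, ← hw s hs.le]
      simp
      ring
    · simp [hE0, profile_zero]
  have hElt : ∀ r, E r ≤ totalArea c := by
    intro r
    rcases le_or_gt r 0 with hr | hr
    · exact (hEmono hr).trans (hE0.le.trans (totalArea_pos hc).le)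
    · refine (lt_totalArea_of_profile_pos hc ?_).le
      rw [← hy r hr.le]
      positivity
  have hbdd : BddAbove (range E) := ⟨totalArea c, by rintro _ ⟨r, rfl⟩; exact hElt r⟩
  have hlim := tendsto_atTop_ciSup hEmono hbdd
  set L := ⨆ r, E r
  have hLm : L ≤ totalArea c := ciSup_le hElt
  have hE1 : 0 < E 1 := by
    refine lt_of_le_of_ne (hE0.symm.le.trans (hEmono zero_le_one)) fun h0 => ?_
    have := hy 1 zero_le_one
    rw [← h0, profile_zero] at this
    exact (by positivity : (1 : ℝ) ^ 2 * Real.exp (2 * u 1) ≠ 0) this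
  have hL0 : 0 < L := hE1.trans_le (le_ciSup hbdd 1)
  -- If L < m, then r E' = P(E) tends to P(L) > 0, which forces logarithmic growth of the bounded
  -- function E.
  have hLeq : L = totalArea c := by
    refine hLm.eq_of_not_lt fun hlt => ?_
    refine not_bddAbove_of_mul_deriv_tendsto (profile_pos hc hL0 hlt) (fun r _ => hEd r) ?_ hbdd
    refine Tendsto.congr' ?_ (((continuous_profile c).tendsto L).comp hlim)
    filter_upwards [eventually_gt_atTop 0] with r hr
    rw [Function.comp, ← hy r hr.le, hρr r hr]
    ring
  have hWlim := ((continuous_profileSlope c).tendsto L).comp hlim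
  rw [hLeq, profileSlope_totalArea hc] at hWlim
  have := hWlim.sub_const 1
  rw [show 1 - totalArea c - 1 = -totalArea c by ring] at this
  refine this.congr' ?_
  filter_upwards [eventually_ge_atTop 0] with r hr
  rw [Function.comp, ← hw r hr]
  ring

theorem continuousOn_totalArea : ContinuousOn totalArea (Ioi (-1)) := fun _ hc =>
  (continuousAt_totalArea hc).continuousWithinAt

theorem exists_totalArea_eq {m : ℝ} (hm : 1 < m) : ∃ c, -1 < c ∧ totalArea c = m := by
  have h := (isPreconnected_Ioi (a := (-1 : ℝ))).intermediate_value_Iio (l₁ := 𝓝[>] (-1))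
    (l₂ := atTop) inf_le_right (le_principal_iff.2 (Ioi_mem_atTop _)) continuousOn_totalArea.neg
    (tendsto_neg_atTop_atBot.comp tendsto_totalArea_neg_one) tendsto_totalArea_atTop.neg
  obtain ⟨c, hc, hcm⟩ := h (show -m < -1 by linarith)
  exact ⟨c, hc, neg_injective hcm⟩

/-! ### Möbius transformations in the affine coordinate -/

/-- The Möbius transformation attached to `δ`, in the affine coordinate. -/
def mobius (δ : GL (Fin 2) ℂ) (z : ℂ) : ℂ := (δ 0 0 * z + δ 0 1) / (δ 1 0 * z + δ 1 1)

theorem smul_coe_eq_mobius {δ : GL (Fin 2) ℂ} {z : ℂ} (h : δ 1 0 * z + δ 1 1 ≠ 0) :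
    δ • (z : Sphere) = (mobius δ z : Sphere) := by
  rw [OnePoint.smul_some_eq_ite, if_neg h]
  rfl

theorem denom_ne_zero_iff {δ : GL (Fin 2) ℂ} {z : ℂ} :
    δ 1 0 * z + δ 1 1 ≠ 0 ↔ δ • (z : Sphere) ≠ OnePoint.infty := by
  rw [OnePoint.smul_some_eq_ite]
  split_ifs with h <;> simp [h]

theorem coord_eq_smul (γ₀ γ : GL (Fin 2) ℂ) (z : ℂ) :
    coord γ z = γ₀ • ((γ₀⁻¹ * γ) • (z : Sphere)) := by
  rw [coord, smul_smul, mul_inv_cancel_left]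

theorem coord_ne_iff (γ₀ γ : GL (Fin 2) ℂ) (z : ℂ) :
    coord γ z ≠ γ₀ • (OnePoint.infty : Sphere) ↔
      (γ₀⁻¹ * γ) 1 0 * z + (γ₀⁻¹ * γ) 1 1 ≠ 0 := by
  rw [denom_ne_zero_iff, coord_eq_smul γ₀, Ne, (MulAction.injective γ₀).eq_iff]

theorem coord_eq_coord_mobius {γ₀ γ : GL (Fin 2) ℂ} {z : ℂ}
    (h : coord γ z ≠ γ₀ • (OnePoint.infty : Sphere)) :
    coord γ z = coord γ₀ (mobius (γ₀⁻¹ * γ) z) := by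
  rw [coord_eq_smul γ₀, smul_coe_eq_mobius ((coord_ne_iff γ₀ γ z).1 h), coord]

theorem coord_injective (γ : GL (Fin 2) ℂ) : Function.Injective (coord γ) := fun _ _ h =>
  OnePoint.coe_injective (MulAction.injective γ h)

theorem denom_mul (δ ε : GL (Fin 2) ℂ) {z : ℂ} (h : ε 1 0 * z + ε 1 1 ≠ 0) :
    (δ * ε) 1 0 * z + (δ * ε) 1 1 =
      (δ 1 0 * mobius ε z + δ 1 1) * (ε 1 0 * z + ε 1 1) := by
  simp only [mobius, Units.val_mul, Matrix.mul_apply, Fin.sum_univ_two]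
  field_simp
  ring

theorem mobiusDeriv_mul (δ ε : GL (Fin 2) ℂ) {z : ℂ} (h : ε 1 0 * z + ε 1 1 ≠ 0) :
    mobiusDeriv (δ * ε) z = mobiusDeriv δ (mobius ε z) * mobiusDeriv ε z := by
  rw [mobiusDeriv, denom_mul δ ε h, mobiusDeriv, mobiusDeriv, div_mul_div_comm, ← mul_pow]
  congr 1
  simp only [Units.val_mul, Matrix.mul_apply, Fin.sum_univ_two]
  ring

theorem mobiusDeriv_ne_zero (δ : GL (Fin 2) ℂ) {z : ℂ} (h : δ 1 0 * z + δ 1 1 ≠ 0) :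
    mobiusDeriv δ z ≠ 0 := by
  refine div_ne_zero ?_ (pow_ne_zero 2 h)
  rw [← Matrix.det_fin_two]
  exact δ.det_ne_zero

theorem contDiffAt_mobius (δ : GL (Fin 2) ℂ) {z : ℂ} (h : δ 1 0 * z + δ 1 1 ≠ 0) :
    ContDiffAt ℝ ∞ (mobius δ) z := by
  have h1 : ContDiffAt ℂ ∞ (fun z => (δ 0 0 * z + δ 0 1) / (δ 1 0 * z + δ 1 1)) z :=
    ContDiffAt.div (by fun_prop) (by fun_prop) h
  exact h1.restrict_scalars ℝ

theorem contDiffAt_mobiusDeriv (δ : GL (Fin 2) ℂ) {z : ℂ} (h : δ 1 0 * z + δ 1 1 ≠ 0) :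
    ContDiffAt ℝ ∞ (mobiusDeriv δ) z := by
  have h1 : ContDiffAt ℂ ∞ (fun z => (δ 0 0 * δ 1 1 - δ 0 1 * δ 1 0) / (δ 1 0 * z + δ 1 1) ^ 2) z :=
    ContDiffAt.div (by fun_prop) (by fun_prop) (pow_ne_zero 2 h)
  exact h1.restrict_scalars ℝ

theorem mobius_one (z : ℂ) : mobius 1 z = z := by simp [mobius]

theorem mobiusDeriv_one (z : ℂ) : mobiusDeriv 1 z = 1 := by simp [mobiusDeriv]

theorem exists_smul_infty_eq (p : Sphere) :
    ∃ γ : GL (Fin 2) ℂ, γ • (OnePoint.infty : Sphere) = p := by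
  induction p using OnePoint.rec with
  | infty => exact ⟨1, one_smul _ _⟩
  | coe w =>
    refine ⟨Matrix.GeneralLinearGroup.mkOfDetNeZero !![w, 1; 1, 0] (by simp), ?_⟩
    rw [OnePoint.smul_infty_eq_ite]
    simp [Matrix.GeneralLinearGroup.mkOfDetNeZero]

/-- The coordinate change `z ↦ 1 / z`. -/
def inversion : GL (Fin 2) ℂ := Matrix.GeneralLinearGroup.mkOfDetNeZero !![0, 1; 1, 0] (by simp)

theorem mobius_inversion (z : ℂ) : mobius inversion z = z⁻¹ := by
  simp [mobius, inversion, Matrix.GeneralLinearGroup.mkOfDetNeZero]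

theorem mobiusDeriv_inversion (z : ℂ) : mobiusDeriv inversion z = -1 / z ^ 2 := by
  simp [mobiusDeriv, inversion, Matrix.GeneralLinearGroup.mkOfDetNeZero]

theorem coord_mul_inversion_zero (γ : GL (Fin 2) ℂ) :
    coord (γ * inversion) 0 = γ • (OnePoint.infty : Sphere) := by
  rw [coord, mul_smul, OnePoint.smul_some_eq_ite]
  simp [inversion, Matrix.GeneralLinearGroup.mkOfDetNeZero]

/-! ### Metrics and functions given in one affine coordinate -/

/-- The conformal metric which in the coordinate `γ₀` is `D(z) |dz|²` on all of `ℂ`. -/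
def metricOfDensity (γ₀ : GL (Fin 2) ℂ) (D : ℂ → ℝ) (hD : ContDiff ℝ ∞ D) (hpos : ∀ z, 0 < D z) :
    ConformalMetric (γ₀ • (OnePoint.infty : Sphere)) where
  density γ z := D (mobius (γ₀⁻¹ * γ) z) * ‖mobiusDeriv (γ₀⁻¹ * γ) z‖ ^ 2
  density_pos γ z h := by
    have := norm_pos_iff.2 (mobiusDeriv_ne_zero _ ((coord_ne_iff γ₀ γ z).1 h))
    exact mul_pos (hpos _) (by positivity)
  density_change γ γ' z z' h hp := by
    have hε : (γ'⁻¹ * γ) • (z : Sphere) = (z' : Sphere) := by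
      rw [mul_smul, inv_smul_eq_iff]
      exact h
    have hne : (γ'⁻¹ * γ) 1 0 * z + (γ'⁻¹ * γ) 1 1 ≠ 0 := by
      rw [denom_ne_zero_iff, hε]
      exact OnePoint.coe_ne_infty _
    have hz' : z' = mobius (γ'⁻¹ * γ) z := by
      rw [smul_coe_eq_mobius hne] at hε
      exact (OnePoint.coe_injective hε).symm
    have hw : mobius (γ₀⁻¹ * γ) z = mobius (γ₀⁻¹ * γ') z' := by
      refine coord_injective γ₀ ?_
      rw [← coord_eq_coord_mobius hp, h, ← coord_eq_coord_mobius (h ▸ hp)]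
    have hδ : γ₀⁻¹ * γ = γ₀⁻¹ * γ' * (γ'⁻¹ * γ) := by group
    rw [hw, mul_assoc]
    congr 1
    nth_rewrite 1 [hδ]
    rw [mobiusDeriv_mul _ _ hne, ← hz', norm_mul, mul_pow]
  density_smooth γ z h := by
    have h1 := (coord_ne_iff γ₀ γ z).1 h
    exact (hD.contDiffAt.comp z (contDiffAt_mobius _ h1)).mul
      ((contDiffAt_mobiusDeriv _ h1).norm_sq ℝ)

section

variable (γ₀ : GL (Fin 2) ℂ) (D : ℂ → ℝ) (hD : ContDiff ℝ ∞ D) (hpos : ∀ z, 0 < D z)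

theorem metricOfDensity_density_self :
    (metricOfDensity γ₀ D hD hpos).density γ₀ = D := by
  funext z
  simp [metricOfDensity, mobius_one, mobiusDeriv_one]

theorem metricOfDensity_density_inversion (z : ℂ) :
    (metricOfDensity γ₀ D hD hpos).density (γ₀ * inversion) z = D z⁻¹ * (‖z‖ ^ 4)⁻¹ := by
  simp only [metricOfDensity, inv_mul_cancel_left, mobius_inversion, mobiusDeriv_inversion]
  rw [norm_div, norm_neg, norm_one, norm_pow, one_div, inv_pow, ← pow_mul]

end

/-- The function on the sphere which in the coordinate `γ₀` is `F` on all of `ℂ`. -/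
def functionOfCoord (γ₀ : GL (Fin 2) ℂ) (F : ℂ → ℝ) (x : Sphere) : ℝ := (γ₀⁻¹ • x).elim 0 F

theorem functionOfCoord_coord (γ₀ : GL (Fin 2) ℂ) (F : ℂ → ℝ) (z : ℂ) :
    functionOfCoord γ₀ F (coord γ₀ z) = F z := by
  rw [functionOfCoord, coord, inv_smul_smul]
  rfl

theorem contDiffAt_functionOfCoord {γ₀ : GL (Fin 2) ℂ} {F : ℂ → ℝ} (hF : ContDiff ℝ ∞ F)
    {γ : GL (Fin 2) ℂ} {z : ℂ} (h : coord γ z ≠ γ₀ • (OnePoint.infty : Sphere)) :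
    ContDiffAt ℝ ∞ (fun w => functionOfCoord γ₀ F (coord γ w)) z := by
  have h1 := (coord_ne_iff γ₀ γ z).1 h
  refine (hF.contDiffAt.comp z (contDiffAt_mobius _ h1)).congr_of_eventuallyEq ?_
  have h2 : ∀ᶠ w in 𝓝 z, (γ₀⁻¹ * γ) 1 0 * w + (γ₀⁻¹ * γ) 1 1 ≠ 0 :=
    ContinuousAt.eventually_ne (by fun_prop) h1
  filter_upwards [h2] with w hw
  rw [coord_eq_coord_mobius ((coord_ne_iff γ₀ γ w).2 hw), functionOfCoord_coord]
  rfl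

theorem exists_coord_eq {γ₀ : GL (Fin 2) ℂ} {x : Sphere}
    (hx : x ≠ γ₀ • (OnePoint.infty : Sphere)) : ∃ z, coord γ₀ z = x := by
  have h : γ₀⁻¹ • x ≠ OnePoint.infty := fun h => hx (by rw [← h, smul_inv_smul])
  obtain ⟨z, hz⟩ := OnePoint.ne_infty_iff_exists.1 h
  exact ⟨z, by rw [coord, hz, smul_inv_smul]⟩

/-! ### Curvature and Hessian for rotationally symmetric conformal metrics -/

/-- The real coordinates `x`, `y` of `z = x + i y`. -/
def realCoord (i : Fin 2) (z : ℂ) : ℝ := ![z.re, z.im] i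

theorem hasFDerivAt_comp_normSq {q : ℝ → ℝ} {q' : ℝ} {z : ℂ} (hq : HasDerivAt q q' (Complex.normSq z)) :
    HasFDerivAt (fun w => q (Complex.normSq w))
      (q' • ((2 * z.re) • Complex.reCLM + (2 * z.im) • Complex.imCLM)) z := by
  have h1 : HasFDerivAt (fun w : ℂ => Complex.normSq w)
      ((2 * z.re) • Complex.reCLM + (2 * z.im) • Complex.imCLM) z := by
    simp only [Complex.normSq_apply]
    refine ((Complex.reCLM.hasFDerivAt.mul Complex.reCLM.hasFDerivAt).add
      (Complex.imCLM.hasFDerivAt.mul Complex.imCLM.hasFDerivAt)).congr_fderiv ?_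
    ext
    · simp
      ring
  exact hq.comp_hasFDerivAt z h1

theorem partialD_comp_normSq {q : ℝ → ℝ} {q' : ℝ} {z : ℂ}
    (hq : HasDerivAt q q' (Complex.normSq z)) (j : Fin 2) :
    partialD j (fun w => q (Complex.normSq w)) z = 2 * q' * realCoord j z := by
  rw [partialD, (hasFDerivAt_comp_normSq hq).fderiv]
  fin_cases j <;> simp [realCoord] <;> ring

theorem partialD_comp_normSq_mul {q : ℝ → ℝ} {q' : ℝ} {z : ℂ}
    (hq : HasDerivAt q q' (Complex.normSq z)) (j i : Fin 2) :
    partialD j (fun w => q (Complex.normSq w) * realCoord i w) z =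
      2 * q' * realCoord j z * realCoord i z + if j = i then q (Complex.normSq z) else 0 := by
  have h0 := hasFDerivAt_comp_normSq hq
  fin_cases i
  · have h1 : HasFDerivAt (realCoord 0) Complex.reCLM z := Complex.reCLM.hasFDerivAt
    have h2 := h0.mul h1
    rw [partialD]
    erw [h2.fderiv]
    fin_cases j <;> simp [realCoord] <;> ring
  · have h1 : HasFDerivAt (realCoord 1) Complex.imCLM z := Complex.imCLM.hasFDerivAt
    have h2 := h0.mul h1
    rw [partialD]
    erw [h2.fderiv]
    fin_cases j <;> simp [realCoord] <;> ring

theorem partialD_neg (j : Fin 2) (F : ℂ → ℝ) (z : ℂ) :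
    partialD j (fun w => -F w) z = -partialD j F z := by
  simp [partialD, fderiv_fun_neg]

theorem inv_smul_one {a : ℝ} : (a • (1 : Matrix (Fin 2) (Fin 2) ℝ))⁻¹ = a⁻¹ • 1 := by
  rcases eq_or_ne a 0 with rfl | h
  · simp
  · refine Matrix.inv_eq_right_inv ?_
    rw [smul_mul_smul_comm, mul_inv_cancel₀ h, one_smul, mul_one]

theorem christoffel_smul_one (D : ℂ → ℝ) (k i j : Fin 2) (z : ℂ) :
    christoffel (fun w => D w • (1 : Matrix (Fin 2) (Fin 2) ℝ)) k i j z =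
      1 / (2 * D z) * ((if j = k then partialD i D z else 0)
        + (if i = k then partialD j D z else 0) - if i = j then partialD k D z else 0) := by
  have h0 : ∀ l : Fin 2, partialD l (fun _ => (0 : ℝ)) z = 0 := fun l => by simp [partialD]
  have h : ∀ l a b : Fin 2, partialD l (fun w => (D w • (1 : Matrix (Fin 2) (Fin 2) ℝ)) a b) z
      = if a = b then partialD l D z else 0 := by
    intro l a b
    by_cases hab : a = b
    · simp [hab]
    · simp [hab, h0]
  simp only [christoffel, h]
  simp only [inv_smul_one, Matrix.smul_apply, Matrix.one_apply, smul_eq_mul]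
  rw [Finset.sum_eq_single k (fun l _ hl => by simp [hl.symm]) (by simp)]
  simp only [if_true]
  rw [one_div, one_div, mul_inv]
  ring

/-- The second-order data of a metric `2 ψ(|z|²) |dz|²` in terms of `q = ψ' / ψ`. -/
theorem christoffel_radial {ψ q : ℝ → ℝ} (hψ : ∀ t, 0 ≤ t → 0 < ψ t)
    (hd : ∀ t, 0 ≤ t → HasDerivAt ψ (q t * ψ t) t) (k i j : Fin 2) (z : ℂ) :
    christoffel (fun w => (2 * ψ (Complex.normSq w)) • (1 : Matrix (Fin 2) (Fin 2) ℝ)) k i j z =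
      q (Complex.normSq z) * ((if j = k then realCoord i z else 0)
        + (if i = k then realCoord j z else 0) - if i = j then realCoord k z else 0) := by
  have h1 : ∀ l, partialD l (fun w => 2 * ψ (Complex.normSq w)) z
      = 2 * (2 * (q (Complex.normSq z) * ψ (Complex.normSq z))) * realCoord l z := fun l =>
    partialD_comp_normSq (q := fun t => 2 * ψ t) ((hd _ (Complex.normSq_nonneg z)).const_mul 2) l
  have h2 := (hψ _ (Complex.normSq_nonneg z)).ne'
  rw [christoffel_smul_one]
  simp only [h1]
  fin_cases i <;> fin_cases j <;> fin_cases k <;> simp <;> field_simp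

/-- This is R e^{2u} = -2Δu for u = ½ log(2ψ(|z|²)), since ΔF(|z|²) = 4(tF')' at t = |z|². -/
theorem scalarCurvature_radial {ψ q : ℝ → ℝ} (hψ : ∀ t, 0 ≤ t → 0 < ψ t)
    (hd : ∀ t, 0 ≤ t → HasDerivAt ψ (q t * ψ t) t) {z : ℂ} {q' : ℝ}
    (hq : HasDerivAt q q' (Complex.normSq z)) :
    scalarCurvature (fun w => (2 * ψ (Complex.normSq w)) • (1 : Matrix (Fin 2) (Fin 2) ℝ)) z
      * (2 * ψ (Complex.normSq z)) = -4 * (q (Complex.normSq z) + Complex.normSq z * q') := by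
  set G : ℂ → Matrix (Fin 2) (Fin 2) ℝ :=
    fun w => (2 * ψ (Complex.normSq w)) • (1 : Matrix (Fin 2) (Fin 2) ℝ) with hG
  have hΓ : ∀ k i j, christoffel G k i j = fun w =>
      q (Complex.normSq w) * ((if j = k then realCoord i w else 0)
        + (if i = k then realCoord j w else 0) - if i = j then realCoord k w else 0) :=
    fun k i j => funext fun w => christoffel_radial hψ hd k i j w
  have h2 := (hψ _ (Complex.normSq_nonneg z)).ne'
  have hx : Complex.normSq z = realCoord 0 z ^ 2 + realCoord 1 z ^ 2 := by
    simp [realCoord, Complex.normSq_apply]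
    ring
  have hp := partialD_comp_normSq_mul hq
  have hn : ∀ j i, partialD j (fun w => -(q (Complex.normSq w) * realCoord i w)) z =
      -(2 * q' * realCoord j z * realCoord i z + if j = i then q (Complex.normSq z) else 0) :=
    fun j i => by rw [partialD_neg, hp]
  have hric : ∀ j, ricci G j j z = -2 * (q (Complex.normSq z) + Complex.normSq z * q') := by
    intro j
    simp only [ricci, hΓ, Fin.sum_univ_two]
    fin_cases j <;> simp [hp, hn] <;> rw [hx] <;> ring
  simp only [scalarCurvature, Fin.sum_univ_two, hG, inv_smul_one, Matrix.smul_apply,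
    Matrix.one_apply]
  rw [← hG, hric, hric]
  simp
  field_simp
  ring

/-- The term 4cψ' x_i x_j of the flat Hessian cancels against the Christoffel terms precisely
because φ' = ψ is proportional to the density; only a multiple of the metric remains. -/
theorem covHessian_radial {φ ψ q : ℝ → ℝ} {c : ℝ} (hψ : ∀ t, 0 ≤ t → 0 < ψ t)
    (hφ : ∀ t, 0 ≤ t → HasDerivAt φ (ψ t) t)
    (hd : ∀ t, 0 ≤ t → HasDerivAt ψ (q t * ψ t) t) (i j : Fin 2) (z : ℂ) :
    covHessian (fun w => (2 * ψ (Complex.normSq w)) • (1 : Matrix (Fin 2) (Fin 2) ℝ))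
      (fun w => c * φ (Complex.normSq w)) i j z =
      if i = j then 2 * c * ψ (Complex.normSq z) * (1 + Complex.normSq z * q (Complex.normSq z))
      else 0 := by
  have h1 : ∀ l, partialD l (fun w => c * φ (Complex.normSq w))
      = fun w => (2 * c * ψ (Complex.normSq w)) * realCoord l w := by
    intro l
    funext w
    rw [partialD_comp_normSq (q := fun t => c * φ t)
      ((hφ _ (Complex.normSq_nonneg w)).const_mul c) l]
    ring
  have hx : Complex.normSq z = realCoord 0 z ^ 2 + realCoord 1 z ^ 2 := by
    simp [realCoord, Complex.normSq_apply]
    ring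
  have h2 := partialD_comp_normSq_mul (q := fun t => 2 * c * ψ t)
    ((hd _ (Complex.normSq_nonneg z)).const_mul (2 * c))
  simp only [covHessian, christoffel_radial hψ hd, Fin.sum_univ_two, h1, h2]
  set Q := q (Complex.normSq z)
  set Ψ := ψ (Complex.normSq z)
  rw [hx]
  fin_cases i <;> fin_cases j <;> simp <;> ring

/-! ### Uniform Hölder bounds under dyadic rescaling -/

theorem le_two_mul_rpow {d α : ℝ} (hd : 0 ≤ d) (hd2 : d ≤ 2) (hα : 0 < α) (hα1 : α < 1) :
    d ≤ 2 * d ^ α := by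
  rcases hd.eq_or_lt with rfl | hd0
  · rw [Real.zero_rpow hα.ne', mul_zero]
  rcases le_or_gt d 1 with h1 | h1
  · have h2 := Real.rpow_le_rpow_of_exponent_ge hd0 h1 hα1.le
    rw [Real.rpow_one] at h2
    have := Real.rpow_nonneg hd α
    linarith
  · have := Real.one_le_rpow h1.le hα.le
    linarith

theorem iteratedFDeriv_comp_clm {E F : Type*} [NormedAddCommGroup E] [NormedSpace ℝ E]
    [NormedAddCommGroup F] [NormedSpace ℝ F] (L : E →L[ℝ] F) {h : F → ℝ} {s : Set F}
    (hs : IsOpen s) {n : ℕ} (hh : ContDiffOn ℝ n h s) {x : E} (hx : L x ∈ s) {i : ℕ} (hi : i ≤ n) :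
    iteratedFDeriv ℝ i (fun y => h (L y)) x =
      (iteratedFDeriv ℝ i h (L x)).compContinuousLinearMap fun _ => L := by
  have hs' : IsOpen (L ⁻¹' s) := hs.preimage L.continuous
  have := L.iteratedFDerivWithin_comp_right hh hs.uniqueDiffOn hs'.uniqueDiffOn hx
    (i := i) (by exact_mod_cast hi)
  rwa [iteratedFDerivWithin_of_isOpen i hs' hx, iteratedFDerivWithin_of_isOpen i hs hx] at this

/-- Rescaling by 2^{-k} is a linear map of norm at most 1, so it does not increase derivatives, and
for large k it sends the strip into a fixed neighbourhood of 0 where `h` is controlled. -/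
theorem exists_holderBoundedBy {h : ℝ → ℝ} (hh : ContDiffAt ℝ ∞ h 0) (l : ℕ) {α : ℝ}
    (hα : 0 < α) (hα1 : α < 1) :
    ∃ (C : ℝ) (k₀ : ℕ), ∀ k ≥ k₀, ∀ F : ℝ × ℝ → ℝ,
      (∀ q ∈ Ioo (1 / 2 : ℝ) 2 ×ˢ (univ : Set ℝ), F q = h (q.1 / 2 ^ k)) →
      HolderBoundedBy l α C F := by
  have hsm : ∀ᶠ x in 𝓝 (0 : ℝ), ContDiffAt ℝ l h x :=
    (hh.of_le (by exact WithTop.coe_le_coe.2 le_top)).eventually (by simp)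
  have hd : ∀ j : ℕ, ContDiffAt ℝ 1 (iteratedFDeriv ℝ j h) 0 := fun j =>
    hh.iteratedFDeriv_right (by exact WithTop.coe_le_coe.2 le_top)
  obtain ⟨K, t, ht, hK⟩ := (hd l).exists_lipschitzOnWith
  have hbd : ∀ j : ℕ, ∀ᶠ x in 𝓝 (0 : ℝ),
      ‖iteratedFDeriv ℝ j h x‖ < ‖iteratedFDeriv ℝ j h 0‖ + 1 := fun j =>
    (hd j).continuousAt.norm.eventually_lt_const (lt_add_one _)
  set M := ∑ j ∈ Finset.range (l + 1), (‖iteratedFDeriv ℝ j h 0‖ + 1) with hM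
  have hbdM : ∀ᶠ x in 𝓝 (0 : ℝ), ∀ j ∈ Finset.range (l + 1), ‖iteratedFDeriv ℝ j h x‖ ≤ M := by
    rw [eventually_all_finset]
    intro j hj
    filter_upwards [hbd j] with x hx
    exact hx.le.trans (Finset.single_le_sum (f := fun j => ‖iteratedFDeriv ℝ j h 0‖ + 1)
      (fun i _ => by positivity) hj)
  obtain ⟨s, hs, hso, h0s⟩ := eventually_nhds_iff.1 ((hsm.and hbdM).and ht)
  obtain ⟨ε, hε, hεs⟩ := Metric.isOpen_iff.1 hso 0 h0s
  obtain ⟨k₀, hk₀⟩ := exists_pow_lt_of_lt_one (half_pos hε) (by norm_num : (1 / 2 : ℝ) < 1)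
  -- `M` bounds the derivatives up to order `l`. `K` is a Lipschitz constant of the `l`-th one; the
  -- factor 2 turns Lipschitz into Hölder through d ≤ 2 d^α for d ≤ 2.
  refine ⟨max M (2 * K), k₀, fun k hk F hF => ?_⟩
  set S := Ioo (1 / 2 : ℝ) 2 ×ˢ (univ : Set ℝ) with hS
  have hSo : IsOpen S := isOpen_Ioo.prod isOpen_univ
  have hk1 : (1 / 2 : ℝ) ^ k < ε / 2 :=
    (pow_le_pow_of_le_one (by norm_num) (by norm_num) hk).trans_lt hk₀
  have hk2 : (1 / 2 : ℝ) ^ k ≤ 1 := pow_le_one₀ (by norm_num) (by norm_num)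
  have hk3 : (0 : ℝ) < (1 / 2) ^ k := by positivity
  set L : ℝ × ℝ →L[ℝ] ℝ := ((1 / 2 : ℝ) ^ k) • ContinuousLinearMap.fst ℝ ℝ ℝ with hL
  have hLq : ∀ q : ℝ × ℝ, L q = (1 / 2 : ℝ) ^ k * q.1 := fun q => by simp [hL]
  have hLq' : ∀ q : ℝ × ℝ, L q = q.1 / 2 ^ k := fun q => by
    rw [hLq, one_div, inv_pow]
    field_simp
  have hLn : ‖L‖ ≤ 1 := by
    rw [hL, norm_smul, Real.norm_of_nonneg hk3.le]
    exact mul_le_one₀ hk2 (norm_nonneg _) (ContinuousLinearMap.norm_fst_le ℝ ℝ ℝ)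
  have hLs : ∀ q ∈ S, L q ∈ s := by
    intro q hq
    refine hεs ?_
    have h1 : 0 < q.1 := lt_trans (by norm_num) hq.1.1
    rw [mem_ball_zero_iff, hLq, Real.norm_of_nonneg (by positivity)]
    calc (1 / 2 : ℝ) ^ k * q.1 ≤ (1 / 2 : ℝ) ^ k * 2 := by gcongr; exact hq.1.2.le
      _ < ε := by linarith
  have hhs : ContDiffOn ℝ l h s := fun x hx => (hs x hx).1.1.contDiffWithinAt
  have hFh : EqOn F (fun q => h (L q)) S := fun q hq => by
    simp only [hLq', hF q hq]
  have hder : ∀ j ≤ l, ∀ q ∈ S, iteratedFDeriv ℝ j F q =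
      (iteratedFDeriv ℝ j h (L q)).compContinuousLinearMap fun _ => L := by
    intro j hj q hq
    rw [← iteratedFDeriv_comp_clm L hso hhs (hLs q hq) hj]
    exact (EventuallyEq.iteratedFDeriv ℝ
      (hFh.eventuallyEq_of_mem (hSo.mem_nhds hq)) j).self_of_nhds
  have hcomp : ∀ (j : ℕ) (A : ContinuousMultilinearMap ℝ (fun _ : Fin j => ℝ) ℝ),
      ‖A.compContinuousLinearMap fun _ => L‖ ≤ ‖A‖ := by
    intro j A
    refine (A.norm_compContinuousLinearMap_le _).trans (mul_le_of_le_one_right (norm_nonneg _) ?_)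
    exact Finset.prod_le_one (fun _ _ => norm_nonneg _) fun _ _ => hLn
  refine ⟨?_, fun j hj q hq => ?_, fun q hq q' hq' => ?_⟩
  · exact (hhs.comp L.contDiff.contDiffOn hLs).congr hFh
  · rw [hder j hj q hq]
    exact (hcomp j _).trans (((hs _ (hLs q hq)).1.2 j (Finset.mem_range.2 (by omega))).trans
      (le_max_left _ _))
  · rw [hder l le_rfl q hq, hder l le_rfl q' hq']
    have h1 : ((iteratedFDeriv ℝ l h (L q)).compContinuousLinearMap fun _ => L) -
        (iteratedFDeriv ℝ l h (L q')).compContinuousLinearMap (fun _ => L) =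
        (iteratedFDeriv ℝ l h (L q) - iteratedFDeriv ℝ l h (L q')).compContinuousLinearMap
          fun _ => L := rfl
    rw [h1]
    have h2 := hK.dist_le_mul _ (hs _ (hLs q hq)).2 _ (hs _ (hLs q' hq')).2
    rw [dist_eq_norm, dist_eq_norm] at h2
    have h3 : ‖L q - L q'‖ ≤ |q.1 - q'.1| := by
      rw [hLq, hLq, ← mul_sub, norm_mul, Real.norm_of_nonneg hk3.le]
      exact mul_le_of_le_one_left (abs_nonneg _) hk2
    have h4 : |q.1 - q'.1| ≤ 2 := by
      rw [abs_le]
      constructor <;> linarith [hq.1.1, hq.1.2, hq'.1.1, hq'.1.2]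
    have h5 := le_two_mul_rpow (abs_nonneg _) h4 hα hα1
    have h6 : |q.1 - q'.1| ^ α ≤ ‖q - q'‖ ^ α :=
      Real.rpow_le_rpow (abs_nonneg _) (norm_fst_le (q - q')) hα.le
    calc _ ≤ ‖iteratedFDeriv ℝ l h (L q) - iteratedFDeriv ℝ l h (L q')‖ := hcomp l _
      _ ≤ K * ‖L q - L q'‖ := h2
      _ ≤ K * (2 * ‖q - q'‖ ^ α) := by gcongr; linarith
      _ = 2 * K * ‖q - q'‖ ^ α := by ring
      _ ≤ max M (2 * K) * ‖q - q'‖ ^ α := by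
        gcongr
        exact le_max_right _ _

/-- Smooth functions of |z|^{2(β+1)} thus become smooth functions of s/2^k, independent of the
angle. -/
theorem norm_conePolar {β : ℝ} (hβ : -1 < β) (k : ℕ) {q : ℝ × ℝ} (hq : 0 < q.1) :
    ‖conePolar β k q‖ ^ (2 * (β + 1)) = ((β + 1) * (q.1 / 2 ^ k)) ^ 2 := by
  have h1 : 0 < β + 1 := by linarith
  have h2 : 0 < (β + 1) * (q.1 / 2 ^ k) := by positivity
  rw [conePolar, norm_mul, Complex.norm_exp_ofReal_mul_I, mul_one, Complex.norm_real,
    Real.norm_of_nonneg (by positivity), ← Real.rpow_mul h2.le,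
    show 1 / (β + 1) * (2 * (β + 1)) = ((2 : ℕ) : ℝ) by push_cast; field_simp, Real.rpow_natCast]

/-! ### Conical singularities of densities that are smooth functions of `|z|^(2(β+1))` -/

section

variable {p : Sphere} {g : ConformalMetric p} {β : ℝ} {γ : GL (Fin 2) ℂ} {V : ℝ → ℝ}

theorem tendsto_norm_rpow (hβ : -1 < β) :
    Tendsto (fun z : ℂ => ‖z‖ ^ (2 * (β + 1))) (𝓝 0) (𝓝 0) := by
  have h1 : 0 < 2 * (β + 1) := by linarith
  have : ContinuousAt (fun z : ℂ => ‖z‖ ^ (2 * (β + 1))) 0 :=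
    continuousAt_id.norm.rpow_const (Or.inr h1.le)
  simpa [ContinuousAt, Real.zero_rpow h1.ne'] using this

theorem hasConicalSingularity_of_smooth (hβ : -1 < β) (hγ : coord γ 0 = p)
    (hV : ContDiffAt ℝ ∞ V 0) (hV0 : 0 < V 0)
    (h : ∀ᶠ z in 𝓝[≠] (0 : ℂ), g.density γ z = V (‖z‖ ^ (2 * (β + 1))) * ‖z‖ ^ (2 * β)) :
    g.HasConicalSingularity β := by
  have h1 : ∀ᶠ x in 𝓝 (0 : ℝ), ContinuousAt V x ∧ 0 < V x :=
    (((hV.of_le (by exact WithTop.coe_le_coe.2 le_top) : ContDiffAt ℝ 1 V 0).eventually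
      (by simp)).mono fun x hx => hx.continuousAt).and
      (hV.continuousAt.eventually_const_lt hV0)
  have h2 := ((tendsto_norm_rpow hβ).eventually h1).and (eventually_nhdsWithin_iff.1 h)
  obtain ⟨U, hU, hUo, h0U⟩ := eventually_nhds_iff.1 h2
  refine ⟨γ, hγ, U, fun z => V (‖z‖ ^ (2 * (β + 1))), hUo, h0U, fun z hz => ?_,
    fun z hz => (hU z hz).1.2, fun z hz hz0 => (hU z hz).2 hz0⟩
  have h3 : ContinuousAt (fun z : ℂ => ‖z‖ ^ (2 * (β + 1))) z :=
    continuousAt_id.norm.rpow_const (Or.inr (by linarith))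
  exact (ContinuousAt.comp (f := fun z : ℂ => ‖z‖ ^ (2 * (β + 1)))
    (hU z hz).1.1 h3).continuousWithinAt

theorem isHolderConeMetric_of_smooth (hβ : -1 < β) (hγ : coord γ 0 = p)
    (hV : ContDiffAt ℝ ∞ V 0) (hV0 : 0 < V 0)
    (h : ∀ᶠ z in 𝓝[≠] (0 : ℂ), g.density γ z = V (‖z‖ ^ (2 * (β + 1))) * ‖z‖ ^ (2 * β))
    (l : ℕ) {α : ℝ} (hα : 0 < α) (hα1 : α < 1) :
    g.IsHolderConeMetric β l α := by
  refine ⟨γ, hγ, fun z => 1 / 2 * Real.log (V (‖z‖ ^ (2 * (β + 1)))), ?_, ?_⟩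
  · have hh : ContDiffAt ℝ ∞ (fun x => 1 / 2 * Real.log (V (((β + 1) * x) ^ 2))) 0 := by
      have h1 : ContDiffAt ℝ ∞ (fun x : ℝ => ((β + 1) * x) ^ 2) 0 := by fun_prop
      have h2 : ContDiffAt ℝ ∞ (fun x : ℝ => V (((β + 1) * x) ^ 2)) 0 :=
        ContDiffAt.comp (f := fun x : ℝ => ((β + 1) * x) ^ 2) 0 (by simpa using hV) h1
      exact contDiffAt_const.mul (h2.log (by simpa using hV0.ne'))
    obtain ⟨C, k₀, hC⟩ := exists_holderBoundedBy hh l hα hα1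
    refine ⟨C, k₀, fun k hk => hC k hk _ fun q hq => ?_⟩
    simp only [norm_conePolar hβ k (lt_trans (by norm_num) hq.1.1 : 0 < q.1)]
  · have h1 : ∀ᶠ z in 𝓝[≠] (0 : ℂ), 0 < V (‖z‖ ^ (2 * (β + 1))) :=
      ((tendsto_norm_rpow hβ).eventually (hV.continuousAt.eventually_const_lt hV0)).filter_mono nhdsWithin_le_nhds
    filter_upwards [h, h1] with z hz hz1
    rw [hz, ← mul_assoc, mul_one_div_cancel two_ne_zero, one_mul, Real.exp_log hz1]

end

/-! ### The soliton metric -/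

theorem contDiff_comp_normSq {ψ : ℝ → ℝ} (h : ∀ t, 0 ≤ t → ContDiffAt ℝ ∞ ψ t) :
    ContDiff ℝ ∞ fun z : ℂ => ψ (Complex.normSq z) := by
  have h1 : ContDiff ℝ ∞ fun z : ℂ => Complex.normSq z := by
    simp only [Complex.normSq_eq_norm_sq]
    exact contDiff_id.norm_sq ℝ
  exact contDiff_iff_contDiffAt.2 fun z =>
    (h _ (Complex.normSq_nonneg z)).comp z h1.contDiffAt

section

variable {c : ℝ} {φ : ℝ → ℝ} (hφ : IsAreaFunction c φ) (γ₀ : GL (Fin 2) ℂ)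

/-- The soliton metric, in the coordinate `γ₀` in which `∞` is the singular point. -/
def solitonMetric : ConformalMetric (γ₀ • (OnePoint.infty : Sphere)) :=
  metricOfDensity γ₀ (fun z => 2 * deriv φ (Complex.normSq z))
    (contDiff_const.mul (contDiff_comp_normSq fun _ ht => hφ.contDiffAt_deriv ht))
    fun z => mul_pos two_pos (hφ.deriv_pos _ (Complex.normSq_nonneg z))

theorem solitonMetric_density_self :
    (solitonMetric hφ γ₀).density γ₀ = fun z => 2 * deriv φ (Complex.normSq z) :=
  metricOfDensity_density_self _ _ _ _

theorem solitonMetric_isRotationallySymmetric :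
    (solitonMetric hφ γ₀).IsRotationallySymmetric := by
  refine ⟨γ₀, rfl, fun a z ha => ?_⟩
  rw [solitonMetric_density_self]
  simp [Complex.normSq_eq_norm_sq, ha]

theorem solitonMetric_isGradientSoliton : (solitonMetric hφ γ₀).IsGradientSoliton 1 := by
  refine ⟨functionOfCoord γ₀ fun z => c * φ (Complex.normSq z), fun γ z h =>
    contDiffAt_functionOfCoord
      (contDiff_const.mul (contDiff_comp_normSq fun _ ht => hφ.smooth _ ht)) h, fun x hx => ?_⟩
  obtain ⟨z, rfl⟩ := exists_coord_eq hx
  refine ⟨γ₀, z, rfl, ?_⟩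
  have hM : (solitonMetric hφ γ₀).matrix γ₀ =
      fun w => (2 * deriv φ (Complex.normSq w)) • (1 : Matrix (Fin 2) (Fin 2) ℝ) := by
    funext w
    rw [ConformalMetric.matrix, solitonMetric_density_self]
  simp only [functionOfCoord_coord, hM]
  set q : ℝ → ℝ := fun t => deriv (deriv φ) t / deriv φ t with hqdef
  have hψ : ∀ t, 0 ≤ t → 0 < deriv φ t := hφ.deriv_pos
  have hd : ∀ t, 0 ≤ t → HasDerivAt (deriv φ) (q t * deriv φ t) t := fun t ht => by
    simp only [hqdef, div_mul_cancel₀ _ (hψ t ht).ne']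
    exact hφ.hasDerivAt_deriv ht
  set t := Complex.normSq z with ht
  have ht0 : 0 ≤ t := Complex.normSq_nonneg z
  have hq : HasDerivAt q (deriv q t) t := by
    have h1 : ContDiffAt ℝ ∞ (deriv (deriv φ)) t :=
      (hφ.contDiffAt_deriv ht0).derivWithin (m := ∞) (by simp)
    exact ((h1.div (hφ.contDiffAt_deriv ht0) (hψ t ht0).ne').differentiableAt
      (by simp)).hasDerivAt
  -- Differentiating t q = W(φ) - 1 gives R = 2(1 + cW), while 1 + t q = W turns the Hessian of f
  -- into cW g; so R/2 - 1 = cW is the soliton equation.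
  have hev : ∀ᶠ s in 𝓝 t, s * q s = profileSlope c (φ s) - 1 := by
    filter_upwards [hφ.eventually_mul_deriv_deriv ht0,
      (hφ.hasDerivAt_deriv ht0).continuousAt.eventually_const_lt (hψ t ht0)] with s hs hs0
    simp only [hqdef]
    rw [← mul_div_assoc, hs, mul_div_cancel_right₀ _ hs0.ne']
  have h1 : q t + t * deriv q t = -(1 + c * profileSlope c (φ t)) * deriv φ t := by
    have h2 := ((hasDerivAt_profileSlope c (φ t)).comp t (hφ.hasDerivAt ht0)).sub_const 1
    have h3 := ((hasDerivAt_id t).mul hq).unique (h2.congr_of_eventuallyEq hev)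
    simpa using h3
  have h2 := hev.self_of_nhds
  have hS := scalarCurvature_radial hψ hd hq
  intro i j
  rw [covHessian_radial hψ (fun t ht => hφ.hasDerivAt ht) hd i j z, ← ht, h2]
  rw [← ht, h1] at hS
  rw [Matrix.smul_apply, Matrix.one_apply]
  split_ifs
  · rw [smul_eq_mul, mul_one, mul_assoc, hS]
    ring
  · simp

/-- In the coordinate 1/z the density is 2φ'(|z|^{-2})|z|^{-4} = P(φ(|z|^{-2}))|z|^{-2}. Setting x =
|z|^{2(m-1)}, so that x^{-1/(m-1)} = |z|^{-2}, gives P = V(x) x and the cone exponent 2(m - 2). -/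
theorem solitonMetric_density_inversion (hc : -1 < c) :
    ∃ V : ℝ → ℝ, ContDiffAt ℝ ∞ V 0 ∧ 0 < V 0 ∧ ∀ᶠ z in 𝓝[≠] (0 : ℂ),
      (solitonMetric hφ γ₀).density (γ₀ * inversion) z =
        V (‖z‖ ^ (2 * (totalArea c - 2 + 1))) * ‖z‖ ^ (2 * (totalArea c - 2)) := by
  obtain ⟨V, hV, hV0, hev⟩ := hφ.at_infinity
  refine ⟨V, hV, hV0, ?_⟩
  have hm := one_lt_totalArea hc
  have hβ : totalArea c - 1 ≠ 0 := by linarith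
  have hlim : Tendsto (fun z : ℂ => ‖z‖ ^ (2 * (totalArea c - 2 + 1))) (𝓝[≠] 0) (𝓝[>] 0) := by
    refine tendsto_nhdsWithin_iff.2
      ⟨(tendsto_norm_rpow (by linarith)).mono_left nhdsWithin_le_nhds, ?_⟩
    filter_upwards [self_mem_nhdsWithin] with z hz
    exact Real.rpow_pos_of_pos (norm_pos_iff.2 hz) _
  filter_upwards [hlim.eventually hev, self_mem_nhdsWithin] with z hz hz0
  have hn : 0 < ‖z‖ := norm_pos_iff.2 hz0
  rw [solitonMetric, metricOfDensity_density_inversion, ← hz, ← Real.rpow_mul hn.le]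
  have h1 : 2 * (totalArea c - 2 + 1) * (-1 / (totalArea c - 1)) = -(2 : ℕ) := by
    field_simp
    push_cast
    ring
  have h2 : ‖z‖ ^ (-((2 : ℕ) : ℝ)) = Complex.normSq z⁻¹ := by
    rw [Real.rpow_neg hn.le, Real.rpow_natCast, Complex.normSq_eq_norm_sq, norm_inv, inv_pow]
  rw [h1, h2]
  have h3 := (hφ.eqn _ (Complex.normSq_nonneg z⁻¹)).self_of_nhds
  have h4 : profile c (φ (Complex.normSq z⁻¹)) =
      2 * ((‖z‖ ^ 2)⁻¹ * deriv φ (Complex.normSq z⁻¹)) := by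
    rw [← inv_pow, ← norm_inv, ← Complex.normSq_eq_norm_sq, h3]
    ring
  have h5 : ‖z‖ ^ (2 * (totalArea c - 2 + 1)) = ‖z‖ ^ (2 * (totalArea c - 2)) * ‖z‖ ^ 2 := by
    rw [← Real.rpow_natCast, ← Real.rpow_add hn]
    congr 1
    push_cast
    ring
  have h6 := Real.rpow_pos_of_pos hn (2 * (totalArea c - 2))
  rw [h4, h5]
  field_simp

end

end ConicalSphere

end

/-! ### The main theorem. -/

theorem theorem5 :
    (∀ (lam : ℝ) (p : ConicalSphere.Sphere), -1 < lam →
      ∃ g : ConicalSphere.ConformalMetric p,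
        g.HasConicalSingularity lam ∧
        (∀ (l : ℕ) (α : ℝ), 0 < α → α < 1 → g.IsHolderConeMetric lam l α) ∧
        g.IsRotationallySymmetric ∧
        g.IsGradientSoliton 1) ∧
    (∀ c : ℝ, -1 < c → ∃ u u' : ℝ → ℝ, ConicalSphere.IsRadialSolution c u u') ∧
    (∃ A : ℝ → ℝ,
      (∀ c : ℝ, -1 < c → ∀ u u' : ℝ → ℝ, ConicalSphere.IsRadialSolution c u u' →
        Tendsto (fun r => r * u' r) atTop (𝓝 (A c))) ∧
      ContinuousOn A (Ioi (-1)) ∧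
      Tendsto A atTop (𝓝 (-1)) ∧
      Tendsto A (𝓝[>] (-1)) atBot) := by
  refine ⟨fun lam p hlam => ?_, fun c hc => ConicalSphere.exists_isRadialSolution hc,
    fun c => -ConicalSphere.totalArea c, fun c hc u u' h => h.tendsto hc,
    ConicalSphere.continuousOn_totalArea.neg, ConicalSphere.tendsto_totalArea_atTop.neg,
    tendsto_neg_atTop_atBot.comp ConicalSphere.tendsto_totalArea_neg_one⟩
  obtain ⟨γ₀, rfl⟩ := ConicalSphere.exists_smul_infty_eq p
  -- The cone order is m - 2, so `c` is chosen with m = λ + 2.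
  obtain ⟨c, hc, hm⟩ := ConicalSphere.exists_totalArea_eq (by linarith : 1 < lam + 2)
  obtain rfl : lam = ConicalSphere.totalArea c - 2 := by linarith
  obtain ⟨φ, hφ⟩ := ConicalSphere.exists_isAreaFunction hc
  obtain ⟨V, hV, hV0, h⟩ := ConicalSphere.solitonMetric_density_inversion hφ γ₀ hc
  have hγ := ConicalSphere.coord_mul_inversion_zero γ₀
  exact ⟨ConicalSphere.solitonMetric hφ γ₀,
    ConicalSphere.hasConicalSingularity_of_smooth hlam hγ hV hV0 h,
    fun l α hα hα1 => ConicalSphere.isHolderConeMetric_of_smooth hlam hγ hV hV0 h l hα hα1,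
    ConicalSphere.solitonMetric_isRotationallySymmetric hφ γ₀,
    ConicalSphere.solitonMetric_isGradientSoliton hφ γ₀⟩
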